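/- Let $\mathrm{Conf}(\mathbb{R})$ be the space of non-negative integer-valued Radon measures on $\mathbb{R}$, with the vague topology (generated by the maps $\xi\mapsto\int f\,d\xi$, $f:\mathbb{R}\to\mathbb{C}$ continuous with compact support) and its Borel $\sigma$-algebra. A point process is a Borel probability measure $\mathbb{P}$ on $\mathrm{Conf}(\mathbb{R})$; it is simple if $\xi(\{x\})\in\{0,1\}$ for all $x\in\mathbb{R}$, for $\mathbb{P}$-almost every $\xi$. A function $\rho^{(k)}:\mathbb{R}^k\to[0,\infty)$ is the $k$-point correlation function of $\mathbb{P}$ if for every continuous compactly supported $\varphi:\mathbb{R}^k\to\mathbb{C}$ $$\int_{\mathrm{Conf}(\mathbb{R})}\ \sum_{x_1,\dots,x_k\in\xi}^{*}\varphi(x_1,\dots,x_k)\,d\mathbb{P}(\xi)=\int_{\mathbb{R}^k}\varphi(x_1,\dots,x_k)\,\rho^{(k)}(x_1,\dots,x_k)\,dx_1\cdots dx_k ,$$ both integrals being absolutely convergent, where $\sum^{*}$ runs over the ordered $k$-tuples of distinct points of $\xi$. Put $S(x)=\frac{\sin(\pi x)}{\pi x}$ (with $S(0)=1$), $IS(x)=\int_0^x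 S(t)\,dt$, $J=\begin{bmatrix}0&1\\-1&0\end{bmatrix}$ and $$K(x,y)=\frac12\begin{bmatrix}S(x-y)&IS(x-y)\\ S'(x-y)&S(x-y)\end{bmatrix}.$$ Let $\mathbb{P}$ be the symplectic sine process ($\mathrm{Sine}_4$), that is, the simple point process on $\mathbb{R}$ which for every $k\ge1$ has the $k$-point correlation function $$\rho^{(k)}(x_1,\dots,x_k)=\mathrm{Pf}\,[K(x_i,x_j)J]_{1\le i,j\le k}.$$ Then $\mathbb{P}$ is number rigid: for every bounded Borel set $B\subset\mathbb{R}$ there is a Borel function $F_B:\mathrm{Conf}(\mathbb{R})\to\mathbb{Z}$ such that $$\xi(B)=F_B(\xi|_{\mathbb{R}\setminus B})\quad\text{for }\mathbb{P}\text{-almost every }\xi\in\mathrm{Conf}(\mathbb{R}).$$ -/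

import Mathlib

open MeasureTheory
open scoped CompactlySupported

namespace PfaffianPP

/-- `Conf(ℝ)`: the non-negative integer-valued Radon measures on `ℝ`, that is, the locally finite
Borel measures all of whose values lie in `ℕ ∪ {∞}` (so bounded sets have a value in `ℕ`). -/
structure Conf where
  /-- the underlying measure -/
  toMeasure : Measure ℝ
  locallyFinite : IsLocallyFiniteMeasure toMeasure
  integerValued : ∀ s : Set ℝ, MeasurableSet s → ∃ n : ℕ∞, toMeasure s = (n : ENNReal)

/-- The vague topology on `Conf(ℝ)`: the coarsest one that makes `ξ ↦ ∫ f dξ` continuous for every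
compactly supported continuous `f : ℝ → ℂ`. -/
noncomputable instance : TopologicalSpace Conf :=
  ⨅ f : C_c(ℝ, ℂ), TopologicalSpace.induced (fun ξ : Conf => ∫ x, f x ∂ξ.toMeasure) inferInstance

/-- `Conf(ℝ)` carries the Borel σ-algebra of the vague topology. -/
noncomputable instance : MeasurableSpace Conf := borel Conf

instance : BorelSpace Conf := ⟨rfl⟩

/-- The restriction `ξ|_S` of a configuration. -/
noncomputable def Conf.restrict (ξ : Conf) (S : Set ℝ) : Conf where
  toMeasure := ξ.toMeasure.restrict S
  locallyFinite := by
    have := ξ.locallyFinite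
    infer_instance
  integerValued := by
    intro s hs
    obtain ⟨n, hn⟩ := ξ.integerValued _ (measurableSet_toMeasurable ξ.toMeasure (s ∩ S))
    exact ⟨n, by rw [Measure.restrict_apply hs, ← hn, measure_toMeasurable]⟩

/-- A configuration is simple if each point has mass `0` or `1`. -/
def Conf.IsSimple (ξ : Conf) : Prop :=
  ∀ x : ℝ, ξ.toMeasure {x} = 0 ∨ ξ.toMeasure {x} = 1

/-- The set of ordered `k`-tuples of distinct points of a configuration. -/
def Conf.distinctTuples (ξ : Conf) (k : ℕ) : Set (Fin k → ℝ) :=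
  {x | Function.Injective x ∧ ∀ i, ξ.toMeasure {x i} ≠ 0}

/-- `∑* φ(x₁, …, x_k)` over the ordered `k`-tuples of distinct points of `ξ`. For compactly
supported `φ` only finitely many terms are nonzero. -/
noncomputable def Conf.tupleSum (ξ : Conf) (k : ℕ) (φ : (Fin k → ℝ) → ℂ) : ℂ :=
  ∑ᶠ x ∈ ξ.distinctTuples k, φ x

/-- A point process (a Borel probability measure on `Conf(ℝ)`) is simple if almost every
configuration is. -/
def IsSimpleProcess (P : Measure Conf) : Prop :=
  ∀ᵐ ξ ∂P, ξ.IsSimple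

/-- Number rigidity: for every bounded Borel set `B` the number `ξ(B)` (which is finite) is almost
surely a Borel function of the restriction of `ξ` to the complement of `B`. -/
def IsNumberRigid (P : Measure Conf) : Prop :=
  ∀ B : Set ℝ, MeasurableSet B → Bornology.IsBounded B →
    ∃ F : Conf → ℤ, Measurable F ∧
      ∀ᵐ ξ ∂P, (ξ.toMeasure B).toReal = (F (ξ.restrict Bᶜ) : ℝ)

/-- `ρ` is the `k`-point correlation function of `P` with respect to Lebesgue measure. The two
integrability clauses say that both sides of the defining identity are genuine integrals. -/
def IsCorrelationFunction (P : Measure Conf) (k : ℕ) (ρ : (Fin k → ℝ) → ℝ) : Prop :=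
  (∀ x, 0 ≤ ρ x) ∧
  ∀ φ : C_c(Fin k → ℝ, ℂ),
    Integrable (fun ξ : Conf => ξ.tupleSum k φ) P ∧
    Integrable (fun x : Fin k → ℝ => φ x * (ρ x : ℂ)) ∧
    ∫ ξ, ξ.tupleSum k φ ∂P = ∫ x : Fin k → ℝ, φ x * (ρ x : ℂ)

/-- The Pfaffian of a `2k × 2k` matrix made of `2 × 2` blocks; the row `(i, a)` is the `a`-th row
of the `i`-th block row:
`Pf A = (2^k k!)⁻¹ ∑_σ sgn(σ) ∏_i A_{σ(i,0), σ(i,1)}`. -/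
noncomputable def pfaffian {k : ℕ} (A : Matrix (Fin k × Fin 2) (Fin k × Fin 2) ℂ) : ℂ :=
  ((2 : ℂ) ^ k * (k.factorial : ℂ))⁻¹ *
    ∑ σ : Equiv.Perm (Fin k × Fin 2),
      ((Equiv.Perm.sign σ : ℤ) : ℂ) * ∏ i : Fin k, A (σ (i, 0)) (σ (i, 1))

/-- The matrix `J`. -/
def matJ : Matrix (Fin 2) (Fin 2) ℂ := !![0, 1; -1, 0]

/-- The block matrix `[K(x_i, x_j) J]_{1 ≤ i, j ≤ k}`. -/
def blockMatrix (K : ℝ → ℝ → Matrix (Fin 2) (Fin 2) ℂ) {k : ℕ} (x : Fin k → ℝ) :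
    Matrix (Fin k × Fin 2) (Fin k × Fin 2) ℂ :=
  Matrix.of fun p q => (K (x p.1) (x q.1) * matJ) p.2 q.2

/-- `P` is the Pfaffian point process induced by the matrix kernel `K`. -/
structure IsPfaffianProcess (P : Measure Conf) (K : ℝ → ℝ → Matrix (Fin 2) (Fin 2) ℂ) : Prop where
  isProbabilityMeasure : IsProbabilityMeasure P
  simple : IsSimpleProcess P
  antisymm : ∀ x y, (K x y * matJ).transpose = -(K y x * matJ)
  correlation : ∀ k : ℕ, 1 ≤ k → ∃ ρ : (Fin k → ℝ) → ℝ,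
    IsCorrelationFunction P k ρ ∧ ∀ x, (ρ x : ℂ) = pfaffian (blockMatrix K x)

/-- `S(x) = sin(πx) / (πx)`, with `S(0) = 1`. -/
noncomputable def sineS (x : ℝ) : ℝ := Real.sinc (Real.pi * x)

/-- `IS(x) = ∫₀ˣ S(t) dt`. -/
noncomputable def sineIS (x : ℝ) : ℝ := ∫ t in (0 : ℝ)..x, sineS t

/-- The matrix kernel of the symplectic sine process. -/
noncomputable def kernelSine4 (x y : ℝ) : Matrix (Fin 2) (Fin 2) ℂ :=
  (1 / 2 : ℂ) • !![(sineS (x - y) : ℂ), (sineIS (x - y) : ℂ);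
                   ((deriv sineS (x - y) : ℝ) : ℂ), (sineS (x - y) : ℂ)]

end PfaffianPP

namespace PfaffianPP

open Filter Topology FourierTransform ProbabilityTheory

/-! The criterion of Ghosh and Peres: if test functions equal to `1` on `B` have linear statistics
of arbitrarily small variance, then along a subsequence `∫ f dξ` minus its mean tends to `0` almost
surely. As `∫ f dξ` is `ξ(B)` plus a quantity depending only on `ξ` outside `B`, the number `ξ(B)`
can be read off from the outside.

The truncated two-point function, at `x - y`, is `-S²/4 + IS·S'/4 = -S²/2 + (IS·S)'/4`. The term
`IS·S'` decays only like `1/|x|`, so the derivative of `G = IS·S` is moved onto the test function.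
This gives (`covariance_linStat`) a determinantal part, `(∫ f g - ∬ f g S²)/2`, and an oscillating
part, `∬ f(x) g'(y) G(x-y) / 4`, with `G` odd and `O(1/|x|)`.

For the dilates of one bump the variance does not tend to `0`, but it stays bounded
(`exists_bound_covariance_dilBump`): both parts are of scale-invariant order. Moreover the
covariance of a fixed dilate with a very wide one tends to `0` (`tendsto_covariance_dilBump`), where
`∫ S² = 1` cancels the leading term. Hence the average of `N` dilates at well separated scales has
variance about `C/N`, and it is still `1` near `B` (`exists_variance_linStat_le`). -/

/-! ### Regularity and decay of the sine kernel and its primitive -/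

lemma contDiff_sinc : ContDiff ℝ 2 Real.sinc := by
  rw [contDiff_iff_contDiffAt]
  intro x
  rcases eq_or_ne x 0 with rfl | hx
  -- At `0`, `sinc` is the divided slope of `sin`, whose power series is that of `sin` shifted by
  -- one.
  · obtain ⟨p, hp⟩ := Real.analyticAt_sin (x := 0)
    rw [Real.sinc_eq_dslope]
    exact (HasFPowerSeriesAt.has_fpower_series_dslope_fslope hp).analyticAt.contDiffAt
  · have h : Real.sinc =ᶠ[𝓝 x] fun y => Real.sin y / y := by
      filter_upwards [isOpen_ne.mem_nhds hx] with y hy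
      exact Real.sinc_of_ne_zero hy
    exact (Real.contDiff_sin.contDiffAt.div contDiffAt_id hx).congr_of_eventuallyEq h

lemma contDiff_sineS : ContDiff ℝ 2 sineS :=
  contDiff_sinc.comp (contDiff_const.mul contDiff_id)

lemma continuous_sineS : Continuous sineS := contDiff_sineS.continuous

lemma continuous_deriv_sineS : Continuous (deriv sineS) :=
  contDiff_sineS.continuous_deriv (by norm_num)

lemma hasDerivAt_sineS (x : ℝ) : HasDerivAt sineS (deriv sineS x) x :=
  (contDiff_sineS.differentiable (by norm_num)).differentiableAt.hasDerivAt

lemma sineS_neg (x : ℝ) : sineS (-x) = sineS x := by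
  simp [sineS]

lemma sineS_zero : sineS 0 = 1 := by simp [sineS]

lemma abs_sineS_le_one (x : ℝ) : |sineS x| ≤ 1 := Real.abs_sinc_le_one _

lemma abs_mul_sineS_le_one (x : ℝ) : |x * sineS x| ≤ 1 := by
  rcases eq_or_ne x 0 with rfl | hx
  · simp
  · have hpi := Real.pi_pos
    have h : x * sineS x = Real.sin (Real.pi * x) / Real.pi := by
      rw [sineS, Real.sinc_of_ne_zero (by positivity)]
      field_simp
    rw [h, abs_div, abs_of_pos hpi, div_le_one hpi]
    exact (Real.abs_sin_le_one _).trans (by linarith [Real.pi_gt_three])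

lemma sineS_sq_le (x : ℝ) : sineS x ^ 2 ≤ 2 * (1 + x ^ 2)⁻¹ := by
  have h1 := abs_sineS_le_one x
  have h2 := abs_mul_sineS_le_one x
  rw [← sq_le_one_iff_abs_le_one] at h1 h2
  rw [← div_eq_mul_inv, le_div_iff₀ (by positivity)]
  nlinarith

lemma integrable_sineS_sq : Integrable (fun x => sineS x ^ 2) := by
  refine (integrable_inv_one_add_sq.const_mul 2).mono'
    (continuous_sineS.pow 2).aestronglyMeasurable (ae_of_all _ fun x => ?_)
  rw [Real.norm_of_nonneg (sq_nonneg _)]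
  exact sineS_sq_le x

lemma hasDerivAt_sineIS (x : ℝ) : HasDerivAt sineIS (sineS x) x :=
  intervalIntegral.integral_hasDerivAt_right (continuous_sineS.intervalIntegrable _ _)
    (continuous_sineS.stronglyMeasurableAtFilter _ _) continuous_sineS.continuousAt

lemma continuous_sineIS : Continuous sineIS :=
  continuous_iff_continuousAt.2 fun x => (hasDerivAt_sineIS x).continuousAt

lemma sineIS_neg (x : ℝ) : sineIS (-x) = -sineIS x := by
  have := intervalIntegral.integral_comp_neg (a := 0) (b := x) sineS
  simp only [sineS_neg, neg_zero] at this
  rw [sineIS, sineIS, this, intervalIntegral.integral_symm]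

/-- Integration by parts: the oscillation of `sin` turns the tail of the conditionally convergent
integral into an absolutely convergent one. -/
lemma exists_abs_sineIS_le : ∃ C, 0 ≤ C ∧ ∀ x, |sineIS x| ≤ C := by
  have hpi := Real.pi_pos
  have hpi3 := Real.pi_gt_three
  -- Adding the boundary term cancels `S` in the derivative and leaves a term of size at most
  -- `1/t²`.
  set F : ℝ → ℝ := fun t => sineIS t + Real.cos (Real.pi * t) / (Real.pi ^ 2 * t) with hF
  have hF' : ∀ t, 1 ≤ t → HasDerivAt F (-(Real.cos (Real.pi * t) / (Real.pi ^ 2 * t ^ 2))) t := by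
    intro t ht
    have ht0 : t ≠ 0 := by positivity
    have h1 : HasDerivAt (fun t => Real.cos (Real.pi * t))
        (-Real.sin (Real.pi * t) * (Real.pi * 1)) t :=
      ((hasDerivAt_id t).const_mul Real.pi).cos
    have h2 : HasDerivAt (fun t => Real.pi ^ 2 * t) (Real.pi ^ 2 * 1) t :=
      (hasDerivAt_id t).const_mul _
    refine ((hasDerivAt_sineIS t).add (h1.div h2 (by positivity))).congr_deriv ?_
    rw [sineS, Real.sinc_of_ne_zero (by positivity)]
    field_simp
    ring
  have hbd : ∀ t, 1 ≤ t → |F t| ≤ |F 1| + 1 := by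
    intro t ht
    have hB : ∀ s : ℝ, 1 ≤ s →
        HasDerivAt (fun t => |F 1| + (1 - t⁻¹)) (s ^ 2)⁻¹ s := fun s hs => by
      have hs0 : s ≠ 0 := by positivity
      exact (((hasDerivAt_inv hs0).const_sub 1).const_add _).congr_deriv (by simp)
    -- Comparison with `|F 1| + 1 - 1/t`, whose derivative `1/t²` dominates `|F'|` because `π² ≥ 1`.
    have := image_norm_le_of_norm_deriv_right_le_deriv_boundary' (f := F)
      (f' := fun t => -(Real.cos (Real.pi * t) / (Real.pi ^ 2 * t ^ 2)))
      (a := 1) (b := t) (B := fun t => |F 1| + (1 - t⁻¹)) (B' := fun t => (t ^ 2)⁻¹)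
      (fun s hs => (hF' s hs.1).continuousAt.continuousWithinAt)
      (fun s hs => (hF' s hs.1).hasDerivWithinAt)
      (by simp)
      (fun s hs => (hB s hs.1).continuousAt.continuousWithinAt)
      (fun s hs => (hB s hs.1).hasDerivWithinAt)
      (fun s hs => by
        have hs0 : 0 < s := zero_lt_one.trans_le hs.1
        rw [norm_neg, Real.norm_eq_abs, abs_div,
          abs_of_pos (show 0 < Real.pi ^ 2 * s ^ 2 by positivity),
          ← one_div]
        gcongr
        · exact Real.abs_cos_le_one _
        · exact le_mul_of_one_le_left (sq_nonneg s) (by nlinarith))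
      ⟨ht, le_rfl⟩
    rw [Real.norm_eq_abs] at this
    have h3 : 0 ≤ t⁻¹ := by positivity
    linarith
  have hpos : ∀ x, 0 ≤ x → |sineIS x| ≤ |F 1| + 2 := by
    intro x hx
    rcases le_total 1 x with h | h
    · have h1 := hbd x h
      have h2 : |Real.cos (Real.pi * x) / (Real.pi ^ 2 * x)| ≤ 1 := by
        rw [abs_div, abs_of_pos (show 0 < Real.pi ^ 2 * x by positivity),
          div_le_one (by positivity)]
        refine (Real.abs_cos_le_one _).trans ?_
        nlinarith
      have h3 : sineIS x = F x - Real.cos (Real.pi * x) / (Real.pi ^ 2 * x) := by simp [hF]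
      rw [h3]
      exact (abs_sub _ _).trans (by linarith)
    · have := intervalIntegral.norm_integral_le_of_norm_le_const (a := 0) (b := x)
        (f := sineS) (C := 1)
        (fun t _ => abs_sineS_le_one t)
      rw [Real.norm_eq_abs, sub_zero, abs_of_nonneg hx] at this
      have h0 := abs_nonneg (F 1)
      rw [sineIS]; linarith
  refine ⟨|F 1| + 2, by positivity, fun x => ?_⟩
  rcases le_total 0 x with h | h
  · exact hpos x h
  · have := hpos (-x) (by linarith)
    rwa [sineIS_neg, abs_neg] at this

/-- The product `IS · S`, whose derivative is the oscillating part of the two-point function. -/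
noncomputable def sineG (x : ℝ) : ℝ := sineIS x * sineS x

lemma hasDerivAt_sineG (x : ℝ) :
    HasDerivAt sineG (sineS x ^ 2 + sineIS x * deriv sineS x) x :=
  ((hasDerivAt_sineIS x).mul (hasDerivAt_sineS x)).congr_deriv (by ring)

lemma continuous_sineG : Continuous sineG := continuous_sineIS.mul continuous_sineS

lemma sineG_neg (x : ℝ) : sineG (-x) = -sineG x := by
  simp [sineG, sineIS_neg, sineS_neg]

lemma exists_abs_sineG_le :
    ∃ C, 0 ≤ C ∧ (∀ x, |sineG x| ≤ C) ∧ ∀ x, |x * sineG x| ≤ C := by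
  obtain ⟨C, hC, h⟩ := exists_abs_sineIS_le
  refine ⟨C, hC, fun x => ?_, fun x => ?_⟩
  · rw [sineG, abs_mul]
    simpa using mul_le_mul (h x) (abs_sineS_le_one x) (abs_nonneg _) hC
  · rw [sineG, mul_left_comm, abs_mul]
    simpa using mul_le_mul (h x) (abs_mul_sineS_le_one x) (abs_nonneg _) hC

lemma tendsto_sineG_cobounded : Tendsto sineG (Bornology.cobounded ℝ) (𝓝 0) := by
  obtain ⟨C, hC, -, h⟩ := exists_abs_sineG_le
  refine squeeze_zero_norm' (a := fun x => C * ‖x‖⁻¹) ?_ ?_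
  · filter_upwards [eventually_cobounded_le_norm (E := ℝ) 1] with x hx
    have := h x
    rw [abs_mul] at this
    rw [← div_eq_mul_inv, le_div_iff₀ (by positivity), mul_comm]
    exact this
  · simpa using (tendsto_inv_atTop_zero.comp (tendsto_norm_cobounded_atTop (E := ℝ))).const_mul C

/-! ### The total mass of `S²` -/

lemma integral_tent_cos {a : ℝ} (ha : a ≠ 0) :
    ∫ x in (0:ℝ)..1, (1 - x) * (2 * Real.cos (a * x)) = 2 * (1 - Real.cos a) / a ^ 2 := by
  have h : ∀ x : ℝ, HasDerivAt
      (fun x => 2 * ((1 - x) * (Real.sin (a * x) / a) - Real.cos (a * x) / a ^ 2))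
      ((1 - x) * (2 * Real.cos (a * x))) x := by
    intro x
    have h1 : HasDerivAt (fun x => Real.sin (a * x)) (Real.cos (a * x) * (a * 1)) x :=
      ((hasDerivAt_id x).const_mul a).sin
    have h2 : HasDerivAt (fun x => Real.cos (a * x)) (-Real.sin (a * x) * (a * 1)) x :=
      ((hasDerivAt_id x).const_mul a).cos
    refine (((((hasDerivAt_id x).const_sub 1).mul (h1.div_const a)).sub
      (h2.div_const (a ^ 2))).const_mul 2).congr_deriv ?_
    simp only [id]
    field_simp
    ring
  rw [intervalIntegral.integral_eq_sub_of_hasDerivAt (fun x _ => h x)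
    (Continuous.intervalIntegrable (by fun_prop) _ _)]
  simp
  field_simp
  ring

/-- The tent function, whose Fourier transform is the square of `S`. -/
noncomputable def tent (x : ℝ) : ℝ := max 0 (1 - |x|)

lemma continuous_tent : Continuous tent := by unfold tent; fun_prop

lemma support_tent_subset : Function.support tent ⊆ Set.Ioc (-1) 1 := by
  intro x hx
  have h : ¬ (1 - |x| ≤ 0) := fun h => hx (max_eq_left h)
  have := abs_lt.1 (show |x| < 1 by linarith)
  exact ⟨this.1, this.2.le⟩

lemma integrable_tent : Integrable tent :=
  continuous_tent.integrable_of_hasCompactSupport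
    (HasCompactSupport.of_support_subset_isCompact isCompact_Icc
      (support_tent_subset.trans Set.Ioc_subset_Icc_self))

lemma fourier_tent {w : ℝ} (hw : w ≠ 0) :
    𝓕 (fun x => (tent x : ℂ)) w = ((sineS w ^ 2 : ℝ) : ℂ) := by
  have hpi := Real.pi_pos
  rw [Real.fourier_real_eq_integral_exp_smul,
    ← intervalIntegral.integral_eq_integral_of_support_subset (a := -1) (b := 1)]
  swap
  · intro x hx
    refine support_tent_subset fun h => hx ?_
    simp [h]
  set g : ℝ → ℂ := fun v => Complex.exp (↑(-2 * Real.pi * v * w) * Complex.I) • (tent v : ℂ) with hg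
  have hgc : Continuous g := by
    have := continuous_tent
    simp only [hg]; fun_prop
  rw [← intervalIntegral.integral_add_adjacent_intervals (b := 0)
    (hgc.intervalIntegrable _ _) (hgc.intervalIntegrable _ _)]
  have h1 := intervalIntegral.integral_comp_neg (a := 0) (b := 1) g
  rw [neg_zero] at h1
  have hgn : Continuous fun x => g (-x) := hgc.comp continuous_neg
  rw [← h1, ← intervalIntegral.integral_add (hgn.intervalIntegrable _ _)
    (hgc.intervalIntegrable _ _)]
  -- Evenness of the tent folds the transform onto `[0, 1]` and turns the exponentials into a
  -- cosine.
  have h2 : ∀ x ∈ Set.uIcc (0 : ℝ) 1, g (-x) + g x =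
      (((1 - x) * (2 * Real.cos (2 * Real.pi * w * x)) : ℝ) : ℂ) := by
    intro x hx
    rw [Set.uIcc_of_le zero_le_one] at hx
    have ht : tent x = 1 - x := by
      rw [tent, abs_of_nonneg hx.1, max_eq_right (by linarith [hx.2])]
    have ht' : tent (-x) = 1 - x := by rw [← ht, tent, tent, abs_neg]
    simp only [hg, ht, ht', smul_eq_mul]
    push_cast
    rw [Complex.two_cos, show -2 * (Real.pi : ℂ) * -(x : ℂ) * w * Complex.I
      = 2 * Real.pi * w * x * Complex.I by ring, show -2 * (Real.pi : ℂ) * (x : ℂ) * w * Complex.I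
      = -(2 * Real.pi * w * x) * Complex.I by ring]
    ring
  rw [intervalIntegral.integral_congr h2, intervalIntegral.integral_ofReal,
    integral_tent_cos (by positivity), sineS, Real.sinc_of_ne_zero (by positivity)]
  congr 1
  rw [show 2 * Real.pi * w = 2 * (Real.pi * w) by ring, Real.cos_two_mul, div_pow, Real.sin_sq]
  field_simp
  ring

/-- Fourier inversion for the tent at the point `0`, where the tent equals `1`. The frequency
excluded in `fourier_tent` is a null set. -/
lemma integral_sineS_sq : ∫ x, sineS x ^ 2 = 1 := by
  have hae : 𝓕 (fun x => (tent x : ℂ)) =ᵐ[volume] fun w => ((sineS w ^ 2 : ℝ) : ℂ) := by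
    filter_upwards [compl_mem_ae_iff.2 (measure_singleton (0 : ℝ))] with w hw
    exact fourier_tent hw
  have h := Integrable.fourierInv_fourier_eq (f := fun x => (tent x : ℂ)) integrable_tent.ofReal
    (integrable_sineS_sq.ofReal.congr hae.symm) (v := 0)
    (Complex.continuous_ofReal.comp continuous_tent).continuousAt
  rw [Real.fourierInv_eq'] at h
  simp only [inner_zero_right, mul_zero, Complex.ofReal_zero, zero_mul, Complex.exp_zero,
    one_smul] at h
  rw [integral_congr_ae hae, integral_complex_ofReal] at h
  simpa [tent] using h

/-! ### Pfaffians of one and two blocks, and the first two correlation functions -/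

/-- Indices in `Fin (k * 2)` let the sum over permutations be expanded recursively with
`Equiv.Perm.decomposeFin`. -/
lemma pfaffian_eq_fin {k : ℕ} (A : Matrix (Fin k × Fin 2) (Fin k × Fin 2) ℂ) :
    pfaffian A = ((2 : ℂ) ^ k * (k.factorial : ℂ))⁻¹ *
      ∑ σ : Equiv.Perm (Fin (k * 2)), ((Equiv.Perm.sign σ : ℤ) : ℂ) *
        ∏ i : Fin k, A (finProdFinEquiv.symm (σ (finProdFinEquiv (i, 0))))
          (finProdFinEquiv.symm (σ (finProdFinEquiv (i, 1)))) := by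
  rw [pfaffian]
  congr 1
  refine Fintype.sum_equiv (Equiv.permCongr finProdFinEquiv) _ _ fun σ => ?_
  simp [Equiv.Perm.sign_permCongr]

lemma pfaffian_one (A : Matrix (Fin 1 × Fin 2) (Fin 1 × Fin 2) ℂ) :
    pfaffian A = (1 / 2) * (A (0, 0) (0, 1) - A (0, 1) (0, 0)) := by
  rw [pfaffian_eq_fin]
  have h0 : finProdFinEquiv ((0 : Fin 1), (0 : Fin 2)) = (0 : Fin 2) := rfl
  have h1 : finProdFinEquiv ((0 : Fin 1), (1 : Fin 2)) = (1 : Fin 2) := rfl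
  have e0 : finProdFinEquiv.symm (0 : Fin 2) = ((0 : Fin 1), (0 : Fin 2)) := rfl
  have e1 : finProdFinEquiv.symm (1 : Fin 2) = ((0 : Fin 1), (1 : Fin 2)) := rfl
  simp only [Fin.prod_univ_one, h0, h1]
  change _ * ∑ σ : Equiv.Perm (Fin 2), _ = _
  rw [← Equiv.sum_comp Equiv.Perm.decomposeFin.symm, Fintype.sum_prod_type]
  simp only [Fin.sum_univ_two, Equiv.Perm.decomposeFin.symm_sign]
  simp [e0, e1]
  ring

lemma sum_perm_fin_four (g : Fin 4 → Fin 4 → Fin 4 → Fin 4 → ℂ) :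
    ∑ σ : Equiv.Perm (Fin 4), ((Equiv.Perm.sign σ : ℤ) : ℂ) * g (σ 0) (σ 1) (σ 2) (σ 3) =
      g 0 1 2 3 - g 0 1 3 2 - g 0 2 1 3 + g 0 2 3 1 - g 0 3 2 1 + g 0 3 1 2
      - g 1 0 2 3 + g 1 0 3 2 + g 1 2 0 3 - g 1 2 3 0 + g 1 3 2 0 - g 1 3 0 2
      - g 2 1 0 3 + g 2 1 3 0 + g 2 0 1 3 - g 2 0 3 1 + g 2 3 0 1 - g 2 3 1 0
      - g 3 1 2 0 + g 3 1 0 2 + g 3 2 1 0 - g 3 2 0 1 + g 3 0 2 1 - g 3 0 1 2 := by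
  have h1 : (1 : Fin 4) = Fin.succ 0 := rfl
  have h2 : (2 : Fin 4) = Fin.succ (Fin.succ 0) := rfl
  have h3 : (3 : Fin 4) = Fin.succ (Fin.succ (Fin.succ 0)) := rfl
  have k1 : (1 : Fin 3) = Fin.succ 0 := rfl
  have k2 : (2 : Fin 3) = Fin.succ (Fin.succ 0) := rfl
  have k3 : (1 : Fin 2) = Fin.succ 0 := rfl
  rw [← Equiv.sum_comp Equiv.Perm.decomposeFin.symm, Fintype.sum_prod_type]
  simp only [Fin.sum_univ_four]
  simp only [← Equiv.sum_comp (Equiv.Perm.decomposeFin (n := 2)).symm, Fintype.sum_prod_type,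
    Fin.sum_univ_three]
  simp only [← Equiv.sum_comp (Equiv.Perm.decomposeFin (n := 1)).symm, Fintype.sum_prod_type,
    Fin.sum_univ_two]
  simp only [Equiv.Perm.decomposeFin.symm_sign, h1, h2, h3, k1, k2, k3,
    Equiv.Perm.decomposeFin_symm_apply_zero, Equiv.Perm.decomposeFin_symm_apply_succ,
    Equiv.swap_apply_def, Fin.succ_inj, Fin.succ_ne_zero, (Fin.succ_ne_zero _).symm,
    if_true, if_false]
  simp
  ring

/-- By antisymmetry the 24 permutations fall into the three perfect matchings of four indices, each
counted `2² · 2! = 8` times. -/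
lemma pfaffian_two (A : Matrix (Fin 2 × Fin 2) (Fin 2 × Fin 2) ℂ) (hA : A.transpose = -A) :
    pfaffian A = A (0, 0) (0, 1) * A (1, 0) (1, 1) - A (0, 0) (1, 0) * A (0, 1) (1, 1)
      + A (0, 0) (1, 1) * A (0, 1) (1, 0) := by
  rw [pfaffian_eq_fin]
  have h : ∀ i j, A j i = -A i j := fun i j => congrFun (congrFun hA i) j
  have h0 : finProdFinEquiv ((0 : Fin 2), (0 : Fin 2)) = (0 : Fin 4) := rfl
  have h1 : finProdFinEquiv ((0 : Fin 2), (1 : Fin 2)) = (1 : Fin 4) := rfl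
  have h2 : finProdFinEquiv ((1 : Fin 2), (0 : Fin 2)) = (2 : Fin 4) := rfl
  have h3 : finProdFinEquiv ((1 : Fin 2), (1 : Fin 2)) = (3 : Fin 4) := rfl
  have e0 : finProdFinEquiv.symm (0 : Fin 4) = ((0 : Fin 2), (0 : Fin 2)) := rfl
  have e1 : finProdFinEquiv.symm (1 : Fin 4) = ((0 : Fin 2), (1 : Fin 2)) := rfl
  have e2 : finProdFinEquiv.symm (2 : Fin 4) = ((1 : Fin 2), (0 : Fin 2)) := rfl
  have e3 : finProdFinEquiv.symm (3 : Fin 4) = ((1 : Fin 2), (1 : Fin 2)) := rfl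
  simp only [Fin.prod_univ_two, h0, h1, h2, h3]
  change _ * ∑ σ : Equiv.Perm (Fin 4), _ = _
  refine (congrArg _ (sum_perm_fin_four fun a b c d =>
    A (finProdFinEquiv.symm a) (finProdFinEquiv.symm b) *
      A (finProdFinEquiv.symm c) (finProdFinEquiv.symm d))).trans ?_
  simp only [e0, e1, e2, e3]
  rw [h (0, 0) (0, 1), h (0, 0) (1, 0), h (0, 0) (1, 1), h (0, 1) (1, 0), h (0, 1) (1, 1),
    h (1, 0) (1, 1)]
  norm_num
  ring

lemma blockMatrix_transpose {K : ℝ → ℝ → Matrix (Fin 2) (Fin 2) ℂ}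
    (hK : ∀ x y, (K x y * matJ).transpose = -(K y x * matJ)) {k : ℕ} (x : Fin k → ℝ) :
    (blockMatrix K x).transpose = -blockMatrix K x := by
  ext p q
  exact congrFun (congrFun (hK (x q.1) (x p.1)) p.2) q.2

lemma pfaffian_kernelSine4_one (x : Fin 1 → ℝ) :
    pfaffian (blockMatrix kernelSine4 x) = 1 / 2 := by
  rw [pfaffian_one]
  simp [blockMatrix, kernelSine4, matJ, Matrix.mul_apply, Fin.sum_univ_two, sineS_zero]
  norm_num

/-- The constant `1 / 4` is the squared density; the other terms are the truncated correlation. -/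
lemma pfaffian_kernelSine4_two
    (hK : ∀ x y, (kernelSine4 x y * matJ).transpose = -(kernelSine4 y x * matJ))
    (x : Fin 2 → ℝ) :
    pfaffian (blockMatrix kernelSine4 x) =
      ((1 / 4 - sineS (x 0 - x 1) ^ 2 / 4 +
        sineIS (x 0 - x 1) * deriv sineS (x 0 - x 1) / 4 : ℝ) : ℂ) := by
  rw [pfaffian_two _ (blockMatrix_transpose hK x)]
  simp [blockMatrix, kernelSine4, matJ, Matrix.mul_apply, Fin.sum_univ_two, sineS_zero]
  ring

/-! ### Atoms of configurations and sums over tuples of points -/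

lemma Conf.one_le_of_ne_zero (ξ : Conf) {s : Set ℝ} (hs : MeasurableSet s)
    (h : ξ.toMeasure s ≠ 0) : 1 ≤ ξ.toMeasure s := by
  obtain ⟨n, hn⟩ := ξ.integerValued s hs
  rw [hn] at h ⊢
  have : n ≠ 0 := by rintro rfl; simp at h
  exact_mod_cast Order.one_le_iff_ne_zero.2 this

/-- The points of positive mass of a configuration. -/
def Conf.atoms (ξ : Conf) : Set ℝ := {x | ξ.toMeasure {x} ≠ 0}

/-- Each atom has mass at least `1`, and a compact set has finite mass. -/
lemma Conf.finite_inter_atoms (ξ : Conf) {K : Set ℝ} (hK : IsCompact K) :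
    (K ∩ ξ.atoms).Finite := by
  have := ξ.locallyFinite
  have h := Measure.finite_const_le_meas_of_disjoint_iUnion ξ.toMeasure (ε := 1) one_pos
    (As := fun x : K => {(x : ℝ)}) (fun _ => measurableSet_singleton _)
    (fun x y hxy => by simpa [Function.onFun, Subtype.ext_iff] using hxy)
    ((measure_mono (Set.iUnion_subset fun x => Set.singleton_subset_iff.2 x.2)).trans_lt
      hK.measure_lt_top).ne
  refine (h.image Subtype.val).subset ?_
  rintro x ⟨hxK, hx⟩
  exact ⟨⟨x, hxK⟩, ξ.one_le_of_ne_zero (measurableSet_singleton _) hx, rfl⟩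

/-- A point of mass `0` has an open neighbourhood of mass below `1`, hence of mass `0` by
integrality. -/
lemma Conf.measure_compl_atoms (ξ : Conf) : ξ.toMeasure ξ.atomsᶜ = 0 := by
  have := ξ.locallyFinite
  refine measure_null_of_locally_null _ fun x hx => ?_
  have hx0 : ξ.toMeasure {x} = 0 := not_not.1 hx
  obtain ⟨U, hU, hUo, hU1⟩ := Set.exists_isOpen_lt_of_lt (μ := ξ.toMeasure) {x} 1
    (by rw [hx0]; exact one_pos)
  refine ⟨U, mem_nhdsWithin_of_mem_nhds (hUo.mem_nhds (hU rfl)), ?_⟩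
  by_contra h
  exact absurd (ξ.one_le_of_ne_zero hUo.measurableSet h) (not_le.2 hU1)

/-- The finitely many atoms in a compact set. -/
noncomputable def Conf.atomsIn (ξ : Conf) {K : Set ℝ} (hK : IsCompact K) : Finset ℝ :=
  (ξ.finite_inter_atoms hK).toFinset

lemma Conf.mem_atomsIn (ξ : Conf) {K : Set ℝ} (hK : IsCompact K) {x : ℝ} :
    x ∈ ξ.atomsIn hK ↔ x ∈ K ∧ ξ.toMeasure {x} ≠ 0 := by
  simp [Conf.atomsIn, Conf.atoms]

/-- The integral of a function vanishing off a compact set is the sum over the atoms there. -/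
lemma Conf.IsSimple.integral_eq_sum {ξ : Conf} (hξ : ξ.IsSimple) {K : Set ℝ} (hK : IsCompact K)
    {f : ℝ → ℝ} (hf : ∀ x ∉ K, f x = 0) :
    ∫ x, f x ∂ξ.toMeasure = ∑ x ∈ ξ.atomsIn hK, f x := by
  have := ξ.locallyFinite
  rw [← setIntegral_eq_integral_of_ae_compl_eq_zero (s := ↑(ξ.atomsIn hK)),
    setIntegral_finset]
  · refine Finset.sum_congr rfl fun x hx => ?_
    have h1 := (hξ x).resolve_left ((ξ.mem_atomsIn hK).1 hx).2
    simp [Measure.real, h1]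
  · rw [← Set.biUnion_of_singleton (s := (↑(ξ.atomsIn hK) : Set ℝ)),
      integrableOn_finite_biUnion (Finset.finite_toSet _)]
    exact fun x _ => integrableOn_singleton (hx := isCompact_singleton.measure_lt_top)
  · have h0 : ∀ᵐ x ∂ξ.toMeasure, x ∈ ξ.atoms := by
      rw [ae_iff]; exact ξ.measure_compl_atoms
    filter_upwards [h0] with x hx hxt
    refine hf x fun hxK => hxt ?_
    exact (ξ.mem_atomsIn hK).2 ⟨hxK, hx⟩

lemma Conf.tupleSum_one (ξ : Conf) {K : Set ℝ} (hK : IsCompact K)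
    {f : ℝ → ℝ} (hf : ∀ x ∉ K, f x = 0) :
    ξ.tupleSum 1 (fun x => (f (x 0) : ℂ)) = ((∑ x ∈ ξ.atomsIn hK, f x : ℝ) : ℂ) := by
  rw [Conf.tupleSum, finsum_mem_eq_of_bijOn (f := fun x : Fin 1 → ℝ => (f (x 0) : ℂ))
    (t := ξ.atoms) (g := fun x => (f x : ℂ))
    (Equiv.funUnique (Fin 1) ℝ) _ (fun x _ => rfl),
    finsum_mem_eq_sum_of_inter_support_eq (t := ξ.atomsIn hK)]
  · push_cast; rfl
  · ext x
    simp only [Set.mem_inter_iff, Function.mem_support, Finset.mem_coe, ξ.mem_atomsIn,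
      Complex.ofReal_ne_zero]
    refine and_congr_left fun hx => ?_
    have : x ∈ K := by_contra fun h => hx (hf x h)
    simp [this, Conf.atoms]
  · refine ⟨fun x hx => hx.2 0, (Equiv.injective _).injOn, fun x hx => ?_⟩
    exact ⟨fun _ => x, ⟨Function.injective_of_subsingleton _, fun _ => hx⟩, rfl⟩

lemma Conf.tupleSum_two (ξ : Conf) {K : Set ℝ} (hK : IsCompact K)
    {f g : ℝ → ℝ} (hf : ∀ x ∉ K, f x = 0) (hg : ∀ x ∉ K, g x = 0) :
    ξ.tupleSum 2 (fun x => ((f (x 0) * g (x 1) : ℝ) : ℂ)) =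
      (((∑ x ∈ ξ.atomsIn hK, f x) * (∑ x ∈ ξ.atomsIn hK, g x) -
        ∑ x ∈ ξ.atomsIn hK, f x * g x : ℝ) : ℂ) := by
  have hsum : ((∑ x ∈ ξ.atomsIn hK, f x) * (∑ x ∈ ξ.atomsIn hK, g x) -
      ∑ x ∈ ξ.atomsIn hK, f x * g x : ℝ) = ∑ p ∈ (ξ.atomsIn hK).offDiag, f p.1 * g p.2 := by
    rw [Finset.sum_mul_sum, ← Finset.sum_product', ← Finset.diag_union_offDiag,
      Finset.sum_union (Finset.disjoint_diag_offDiag _), Finset.sum_diag]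
    ring
  rw [hsum, Conf.tupleSum, finsum_mem_eq_of_bijOn
    (f := fun x : Fin 2 → ℝ => ((f (x 0) * g (x 1) : ℝ) : ℂ))
    (t := {p : ℝ × ℝ | p.1 ∈ ξ.atoms ∧ p.2 ∈ ξ.atoms ∧ p.1 ≠ p.2})
    (g := fun p => ((f p.1 * g p.2 : ℝ) : ℂ)) (finTwoArrowEquiv ℝ) _ (fun x _ => rfl),
    finsum_mem_eq_sum_of_inter_support_eq (t := (ξ.atomsIn hK).offDiag)]
  · push_cast; rfl
  · ext ⟨x, y⟩
    simp only [Set.mem_inter_iff, Function.mem_support, Finset.mem_coe, Finset.mem_offDiag,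
      ξ.mem_atomsIn, Complex.ofReal_ne_zero, mul_ne_zero_iff, Set.mem_ofPred_eq]
    refine and_congr_left fun h => ?_
    have hx : x ∈ K := by_contra fun hx => h.1 (hf x hx)
    have hy : y ∈ K := by_contra fun hy => h.2 (hg y hy)
    simp [hx, hy, Conf.atoms]
  · refine ⟨fun x hx => ⟨hx.2 0, hx.2 1, fun h => ?_⟩, (Equiv.injective _).injOn, ?_⟩
    · exact absurd (hx.1 h) (by decide)
    · rintro ⟨x, y⟩ ⟨hx, hy, hxy⟩
      refine ⟨![x, y], ⟨?_, ?_⟩, rfl⟩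
      · intro i j hij
        fin_cases i <;> fin_cases j <;> simp_all
      · intro i
        fin_cases i <;> simpa [Conf.atoms]

lemma Conf.IsSimple.tupleSum_one {ξ : Conf} (hξ : ξ.IsSimple) {f : ℝ → ℝ}
    (hf : HasCompactSupport f) :
    ξ.tupleSum 1 (fun x => (f (x 0) : ℂ)) = ((∫ x, f x ∂ξ.toMeasure : ℝ) : ℂ) := by
  have h : ∀ x ∉ tsupport f, f x = 0 := fun x hx => image_eq_zero_of_notMem_tsupport hx
  rw [ξ.tupleSum_one hf h, hξ.integral_eq_sum hf h]

lemma Conf.IsSimple.tupleSum_two {ξ : Conf} (hξ : ξ.IsSimple) {f g : ℝ → ℝ}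
    (hf : HasCompactSupport f) (hg : HasCompactSupport g) :
    ξ.tupleSum 2 (fun x => ((f (x 0) * g (x 1) : ℝ) : ℂ)) =
      (((∫ x, f x ∂ξ.toMeasure) * (∫ x, g x ∂ξ.toMeasure) -
        ∫ x, f x * g x ∂ξ.toMeasure : ℝ) : ℂ) := by
  have hK : IsCompact (tsupport f ∪ tsupport g) := IsCompact.union hf hg
  have h1 : ∀ x ∉ tsupport f ∪ tsupport g, f x = 0 := fun x hx =>
    image_eq_zero_of_notMem_tsupport fun h => hx (Or.inl h)
  have h2 : ∀ x ∉ tsupport f ∪ tsupport g, g x = 0 := fun x hx =>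
    image_eq_zero_of_notMem_tsupport fun h => hx (Or.inr h)
  rw [ξ.tupleSum_two hK h1 h2, hξ.integral_eq_sum hK h1, hξ.integral_eq_sum hK h2,
    hξ.integral_eq_sum hK fun x hx => by rw [h1 x hx, zero_mul]]

/-! ### Moments and covariances of linear statistics -/

/-- The linear statistic `∫ f dξ` of a configuration. -/
noncomputable def Conf.linStat (f : ℝ → ℝ) (ξ : Conf) : ℝ := ∫ x, f x ∂ξ.toMeasure

lemma continuous_mul_comp {f g : ℝ → ℝ} {k : ℝ → ℝ} (hf : Continuous f) (hg : Continuous g)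
    (hk : Continuous k) : Continuous fun p : ℝ × ℝ => f p.1 * g p.2 * k (p.1 - p.2) := by
  fun_prop

lemma integrable_mul_mul_sub {f g k : ℝ → ℝ} (hf : Continuous f) (hfc : HasCompactSupport f)
    (hg : Continuous g) (hgc : HasCompactSupport g) (hk : Continuous k) :
    Integrable fun p : ℝ × ℝ => f p.1 * g p.2 * k (p.1 - p.2) := by
  refine (continuous_mul_comp hf hg hk).integrable_of_hasCompactSupport ?_
  refine HasCompactSupport.of_support_subset_isCompact
    (IsCompact.prod (s := tsupport f) (t := tsupport g) hfc hgc) fun p hp => ⟨?_, ?_⟩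
  · exact subset_tsupport _ fun h => hp (by simp [h])
  · exact subset_tsupport _ fun h => hp (by simp [h])

/-- Integration by parts in the second variable; the sign from differentiating `y ↦ G(x - y)`
cancels the sign of the formula. -/
lemma integral_mul_deriv_sineG {f g : ℝ → ℝ} (hf : Continuous f) (hfc : HasCompactSupport f)
    (hg : ContDiff ℝ 1 g) (hgc : HasCompactSupport g) :
    ∫ p : ℝ × ℝ, f p.1 * g p.2 *
        (sineS (p.1 - p.2) ^ 2 + sineIS (p.1 - p.2) * deriv sineS (p.1 - p.2)) =
      ∫ p : ℝ × ℝ, f p.1 * deriv g p.2 * sineG (p.1 - p.2) := by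
  have hk : Continuous fun u => sineS u ^ 2 + sineIS u * deriv sineS u :=
    (continuous_sineS.pow 2).add (continuous_sineIS.mul continuous_deriv_sineS)
  have hg' : Continuous (deriv g) := hg.continuous_deriv le_rfl
  have hG := continuous_sineG
  rw [Measure.volume_eq_prod,
    integral_prod _ (integrable_mul_mul_sub hf hfc hg.continuous hgc hk),
    integral_prod _ (integrable_mul_mul_sub hf hfc hg' hgc.deriv hG)]
  refine integral_congr_ae (ae_of_all _ fun x => ?_)
  simp only [mul_assoc, integral_const_mul]
  congr 1
  have h := integral_mul_deriv_eq_deriv_mul_of_integrable (u := g) (u' := deriv g)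
    (v := fun y => sineG (x - y))
    (v' := fun y => -(sineS (x - y) ^ 2 + sineIS (x - y) * deriv sineS (x - y)))
    (fun y _ => (hg.differentiable one_ne_zero y).hasDerivAt)
    (fun y _ => ((hasDerivAt_sineG (x - y)).comp y ((hasDerivAt_id y).const_sub x)).congr_deriv
      (by ring))
    (Continuous.integrable_of_hasCompactSupport
      (hg.continuous.mul (hk.comp (continuous_sub_left x)).neg) hgc.mul_right)
    (Continuous.integrable_of_hasCompactSupport
      (hg'.mul (hG.comp (continuous_sub_left x))) hgc.deriv.mul_right)
    (Continuous.integrable_of_hasCompactSupport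
      (hg.continuous.mul (hG.comp (continuous_sub_left x))) hgc.mul_right)
  simp only [mul_neg, integral_neg] at h
  linarith

lemma integrable_linStat_and_integral {P : Measure Conf} (hP : IsPfaffianProcess P kernelSine4)
    {f : ℝ → ℝ} (hf : Continuous f)
    (hfc : HasCompactSupport f) :
    Integrable (Conf.linStat f) P ∧ ∫ ξ, Conf.linStat f ξ ∂P = (1 / 2) * ∫ x, f x := by
  obtain ⟨ρ, hρ, hρ'⟩ := hP.correlation 1 le_rfl
  have hρ1 : ∀ x, ρ x = 1 / 2 := fun x => by
    have := hρ' x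
    rw [pfaffian_kernelSine4_one] at this
    exact Complex.ofReal_injective (by rw [this]; norm_num)
  let φ : C_c(Fin 1 → ℝ, ℂ) :=
    { toFun := fun x => (f (x 0) : ℂ)
      continuous_toFun := by fun_prop
      hasCompactSupport' := by
        refine HasCompactSupport.of_support_subset_isCompact
          (isCompact_univ_pi fun _ : Fin 1 => (hfc : IsCompact (tsupport f))) fun x hx i _ => ?_
        rw [Subsingleton.elim i 0]
        exact subset_tsupport _ fun h => hx (by simp [h]) }
  obtain ⟨h1, -, h3⟩ := hρ.2 φ
  have hae : (fun ξ : Conf => ξ.tupleSum 1 φ) =ᵐ[P] fun ξ => ((Conf.linStat f ξ : ℝ) : ℂ) := by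
    filter_upwards [hP.simple] with ξ hξ
    exact hξ.tupleSum_one hfc
  refine ⟨by simpa using (h1.congr hae).re, ?_⟩
  rw [integral_congr_ae hae, integral_complex_ofReal] at h3
  have h4 : ∫ x, φ x * (ρ x : ℂ) = (((1 / 2) * ∫ x, f x : ℝ) : ℂ) := by
    have h5 : (fun x => φ x * (ρ x : ℂ)) = fun x => ((f (x 0) * (1 / 2) : ℝ) : ℂ) := by
      ext x; rw [hρ1]; push_cast; rfl
    rw [h5, integral_complex_ofReal, integral_mul_const, mul_comm]
    congr 2
    exact (volume_preserving_funUnique (Fin 1) ℝ).integral_comp' f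
  rw [h4] at h3
  exact_mod_cast h3

/-- The correlation function sees only distinct pairs; the diagonal is restored by the mean of the
statistic of `f g`, which gives the first term. -/
lemma integrable_linStat_mul_and_integral {P : Measure Conf} (hP : IsPfaffianProcess P kernelSine4)
    {f g : ℝ → ℝ} (hf : Continuous f)
    (hfc : HasCompactSupport f) (hg : Continuous g) (hgc : HasCompactSupport g) :
    Integrable (fun ξ => Conf.linStat f ξ * Conf.linStat g ξ) P ∧
    ∫ ξ, Conf.linStat f ξ * Conf.linStat g ξ ∂P = (1 / 2) * (∫ x, f x * g x) +
      ∫ p : ℝ × ℝ, f p.1 * g p.2 * (1 / 4 - sineS (p.1 - p.2) ^ 2 / 4 +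
        sineIS (p.1 - p.2) * deriv sineS (p.1 - p.2) / 4) := by
  obtain ⟨ρ, hρ, hρ'⟩ := hP.correlation 2 one_le_two
  have hρ1 : ∀ x, ρ x = 1 / 4 - sineS (x 0 - x 1) ^ 2 / 4 +
        sineIS (x 0 - x 1) * deriv sineS (x 0 - x 1) / 4 := fun x => by
    have := hρ' x
    rw [pfaffian_kernelSine4_two hP.antisymm] at this
    exact_mod_cast this
  let φ : C_c(Fin 2 → ℝ, ℂ) :=
    { toFun := fun x => ((f (x 0) * g (x 1) : ℝ) : ℂ)
      continuous_toFun := by fun_prop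
      hasCompactSupport' := by
        refine HasCompactSupport.of_support_subset_isCompact
          (isCompact_univ_pi fun _ : Fin 2 => IsCompact.union hfc hgc) fun x hx i _ => ?_
        fin_cases i
        · exact Or.inl (subset_tsupport _ fun h => hx (by simp at h; simp [h]))
        · exact Or.inr (subset_tsupport _ fun h => hx (by simp at h; simp [h])) }
  obtain ⟨h1, -, h3⟩ := hρ.2 φ
  have hae : (fun ξ : Conf => ξ.tupleSum 2 φ) =ᵐ[P] fun ξ =>
      ((Conf.linStat f ξ * Conf.linStat g ξ - Conf.linStat (fun x => f x * g x) ξ : ℝ) : ℂ) := by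
    filter_upwards [hP.simple] with ξ hξ
    exact hξ.tupleSum_two hfc hgc
  obtain ⟨h6, h7⟩ := integrable_linStat_and_integral hP (f := fun x => f x * g x)
    (hf.mul hg) (hfc.mul_right (f' := g))
  have h8 : Integrable (fun ξ => Conf.linStat f ξ * Conf.linStat g ξ
      - Conf.linStat (fun x => f x * g x) ξ) P := by simpa using (h1.congr hae).re
  have h9 : Integrable (fun ξ => Conf.linStat f ξ * Conf.linStat g ξ) P := by
    simpa [Pi.add_def] using h8.add h6
  refine ⟨h9, ?_⟩
  rw [integral_congr_ae hae, integral_complex_ofReal, integral_sub h9 h6] at h3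
  have h4 : ∫ x, φ x * (ρ x : ℂ) =
      ((∫ p : ℝ × ℝ, f p.1 * g p.2 * (1 / 4 - sineS (p.1 - p.2) ^ 2 / 4 +
        sineIS (p.1 - p.2) * deriv sineS (p.1 - p.2) / 4) : ℝ) : ℂ) := by
    have h5 : (fun x => φ x * (ρ x : ℂ)) = fun x : Fin 2 → ℝ =>
        ((f (x 0) * g (x 1) * (1 / 4 - sineS (x 0 - x 1) ^ 2 / 4 +
        sineIS (x 0 - x 1) * deriv sineS (x 0 - x 1) / 4) : ℝ) : ℂ) := by
      ext x; rw [hρ1, Complex.ofReal_mul]; rfl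
    rw [h5, integral_complex_ofReal]
    congr 1
    exact (volume_preserving_finTwoArrow ℝ).integral_comp'
      fun p => f p.1 * g p.2 * (1 / 4 - sineS (p.1 - p.2) ^ 2 / 4 +
        sineIS (p.1 - p.2) * deriv sineS (p.1 - p.2) / 4)
  rw [h4] at h3
  have h10 := Complex.ofReal_injective h3
  linarith

lemma memLp_linStat {P : Measure Conf} (hP : IsPfaffianProcess P kernelSine4)
    {f : ℝ → ℝ} (hf : Continuous f) (hfc : HasCompactSupport f) :
    MemLp (Conf.linStat f) 2 P := by
  rw [memLp_two_iff_integrable_sq (integrable_linStat_and_integral hP hf hfc).1.1]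
  simpa [sq] using (integrable_linStat_mul_and_integral hP hf hfc hf hfc).1

/-- The `1/4` in the two-point function cancels the product of the means. One quarter of `S²` is
added and subtracted to complete the derivative of `sineG`, whence the factor `1/2` of the first
part. -/
lemma covariance_linStat {P : Measure Conf} (hP : IsPfaffianProcess P kernelSine4)
    {f g : ℝ → ℝ} (hf : Continuous f) (hfc : HasCompactSupport f)
    (hg : ContDiff ℝ 1 g) (hgc : HasCompactSupport g) :
    cov[Conf.linStat f, Conf.linStat g; P] =
      (1 / 2) * ((∫ x, f x * g x) - ∫ p : ℝ × ℝ, f p.1 * g p.2 * sineS (p.1 - p.2) ^ 2) +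
      (1 / 4) * ∫ p : ℝ × ℝ, f p.1 * deriv g p.2 * sineG (p.1 - p.2) := by
  have := hP.isProbabilityMeasure
  have hg0 := hg.continuous
  rw [covariance_eq_sub (memLp_linStat hP hf hfc) (memLp_linStat hP hg0 hgc),
    (integrable_linStat_and_integral hP hf hfc).2, (integrable_linStat_and_integral hP hg0 hgc).2]
  simp only [Pi.mul_apply]
  rw [(integrable_linStat_mul_and_integral hP hf hfc hg0 hgc).2,
    ← integral_mul_deriv_sineG hf hfc hg hgc]
  have hk : Continuous fun u => sineS u ^ 2 + sineIS u * deriv sineS u :=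
    (continuous_sineS.pow 2).add (continuous_sineIS.mul continuous_deriv_sineS)
  have i1 := integrable_mul_mul_sub hf hfc hg0 hgc hk
  have i2 : Integrable fun p : ℝ × ℝ => f p.1 * g p.2 * sineS (p.1 - p.2) ^ 2 :=
    integrable_mul_mul_sub hf hfc hg0 hgc (continuous_sineS.pow 2)
  have i3 := integrable_mul_mul_sub hf hfc hg0 hgc (continuous_const (y := (1 : ℝ)))
  have i4 : Integrable fun p : ℝ × ℝ => (1 / 4) * (f p.1 * g p.2 * 1) -
      (1 / 2) * (f p.1 * g p.2 * sineS (p.1 - p.2) ^ 2) := (i3.const_mul _).sub (i2.const_mul _)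
  have e : ∀ p : ℝ × ℝ, f p.1 * g p.2 * (1 / 4 - sineS (p.1 - p.2) ^ 2 / 4 +
        sineIS (p.1 - p.2) * deriv sineS (p.1 - p.2) / 4) =
      (1 / 4) * (f p.1 * g p.2 * 1) - (1 / 2) * (f p.1 * g p.2 * sineS (p.1 - p.2) ^ 2) +
      (1 / 4) * (f p.1 * g p.2 *
        (sineS (p.1 - p.2) ^ 2 + sineIS (p.1 - p.2) * deriv sineS (p.1 - p.2))) :=
    fun p => by ring
  rw [integral_congr_ae (ae_of_all _ e), integral_add i4
    (i1.const_mul _), integral_sub (i3.const_mul _) (i2.const_mul _), integral_const_mul,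
    integral_const_mul, integral_const_mul]
  have h0 : ∫ p : ℝ × ℝ, f p.1 * g p.2 * 1 = (∫ x, f x) * ∫ x, g x := by
    simp only [mul_one]
    exact integral_prod_mul f g
  rw [h0]
  ring

/-! ### Dilated bump functions -/

/-- A smooth bump function equal to `1` on `[-1, 1]` and supported in `[-2, 2]`. -/
noncomputable def bump : ContDiffBump (0 : ℝ) := ⟨1, 2, one_pos, one_lt_two⟩

/-- The bump function dilated by the factor `c`. -/
noncomputable def dilBump (c x : ℝ) : ℝ := bump (x / c)

lemma bump_eq_zero {x : ℝ} (hx : 2 ≤ |x|) : bump x = 0 :=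
  bump.zero_of_le_dist (by simpa [Real.dist_eq, bump] using hx)

lemma bump_eq_one {x : ℝ} (hx : |x| ≤ 1) : bump x = 1 :=
  bump.one_of_mem_closedBall (by simpa [bump] using hx)

lemma contDiff_bump : ContDiff ℝ 2 bump := bump.contDiff

lemma hasCompactSupport_bump : HasCompactSupport (bump : ℝ → ℝ) := bump.hasCompactSupport

lemma continuous_deriv_bump : Continuous (deriv bump) :=
  contDiff_bump.continuous_deriv (by norm_num)

lemma deriv_bump_eq_zero {x : ℝ} (hx : 2 < |x|) : deriv bump x = 0 := by
  have : (bump : ℝ → ℝ) =ᶠ[𝓝 x] fun _ => 0 := by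
    filter_upwards [(isOpen_lt continuous_const continuous_abs).mem_nhds hx] with y hy
    exact bump_eq_zero (le_of_lt hy)
  rw [this.deriv_eq]; simp

lemma exists_lipschitz_bump : ∃ L : ℝ, 0 ≤ L ∧ (∀ x y, |bump x - bump y| ≤ L * |x - y|) ∧
    (∀ x y, |deriv bump x - deriv bump y| ≤ L * |x - y|) ∧ ∀ x, |deriv bump x| ≤ L := by
  obtain ⟨L₁, h₁⟩ := contDiff_bump.lipschitzWith_of_hasCompactSupport hasCompactSupport_bump
    two_ne_zero
  have hd : ContDiff ℝ 1 (deriv bump) := by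
    have := contDiff_bump
    rw [show (2 : WithTop ℕ∞) = 1 + 1 by norm_num, contDiff_succ_iff_deriv] at this
    exact this.2.2
  obtain ⟨L₂, h₂⟩ := hd.lipschitzWith_of_hasCompactSupport hasCompactSupport_bump.deriv one_ne_zero
  refine ⟨max L₁ L₂, by positivity, fun x y => ?_, fun x y => ?_, fun x => ?_⟩
  · refine (h₁.dist_le_mul x y).trans ?_
    rw [Real.dist_eq]
    gcongr
    exact le_max_left _ _
  · refine (h₂.dist_le_mul x y).trans ?_
    rw [Real.dist_eq]
    gcongr
    exact le_max_right _ _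
  · exact (norm_deriv_le_of_lipschitz h₁).trans (le_max_left _ _)

section dil

variable {c : ℝ}

lemma dilBump_mem_Icc (c x : ℝ) : dilBump c x ∈ Set.Icc 0 1 := ⟨bump.nonneg, bump.le_one⟩

lemma contDiff_dilBump (c : ℝ) : ContDiff ℝ 2 (dilBump c) :=
  contDiff_bump.comp (contDiff_id.div_const c)

lemma continuous_dilBump (c : ℝ) : Continuous (dilBump c) := (contDiff_dilBump c).continuous

lemma dilBump_eq_one (hc : 0 < c) {x : ℝ} (hx : |x| ≤ c) : dilBump c x = 1 :=
  bump_eq_one (by rwa [abs_div, abs_of_pos hc, div_le_one hc])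

lemma dilBump_eq_zero (hc : 0 < c) {x : ℝ} (hx : x ∉ Set.Icc (-(2 * c)) (2 * c)) :
    dilBump c x = 0 := by
  refine bump_eq_zero ?_
  rw [abs_div, abs_of_pos hc, le_div_iff₀ hc]
  rw [Set.mem_Icc, ← abs_le, not_le] at hx
  exact hx.le

lemma hasCompactSupport_dilBump (hc : 0 < c) : HasCompactSupport (dilBump c) :=
  HasCompactSupport.intro isCompact_Icc fun _ hx => dilBump_eq_zero hc hx

lemma deriv_dilBump (c x : ℝ) : deriv (dilBump c) x = deriv bump (x / c) / c := by
  have h := (contDiff_bump.differentiable two_ne_zero (x / c)).hasDerivAt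
  exact ((h.comp x ((hasDerivAt_id x).div_const c)).congr_deriv (by simp [div_eq_mul_inv])).deriv

lemma deriv_dilBump_eq_zero (hc : 0 < c) {x : ℝ} (hx : x ∉ Set.Icc (-(2 * c)) (2 * c)) :
    deriv (dilBump c) x = 0 := by
  rw [deriv_dilBump, deriv_bump_eq_zero, zero_div]
  rw [abs_div, abs_of_pos hc, lt_div_iff₀ hc]
  rwa [Set.mem_Icc, ← abs_le, not_le] at hx

end dil

/-! ### Variances bounded uniformly in the scale -/

lemma integrable_mul_comp_sub {h k : ℝ → ℝ} (hh : Integrable h) (hk : Integrable k) :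
    Integrable fun p : ℝ × ℝ => h p.2 * k (p.1 - p.2) := by
  exact hh.convolution_integrand (ContinuousLinearMap.mul ℝ ℝ) hk

lemma integral_mul_comp_sub {h k : ℝ → ℝ} (hh : Integrable h) (hk : Integrable k) :
    ∫ p : ℝ × ℝ, h p.2 * k (p.1 - p.2) = (∫ x, h x) * ∫ x, k x := by
  rw [Measure.volume_eq_prod, integral_prod_symm _ (integrable_mul_comp_sub hh hk),
    ← integral_mul_const]
  refine integral_congr_ae (ae_of_all _ fun y => ?_)
  simp only [integral_const_mul, integral_sub_right_eq_self k y]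

lemma integrable_mul_comp_sub' {h k : ℝ → ℝ} (hh : Integrable h) (hk : Integrable k)
    (hke : ∀ x, k (-x) = k x) :
    Integrable fun p : ℝ × ℝ => h p.1 * k (p.1 - p.2) := by
  have := (integrable_mul_comp_sub hh hk).swap
  refine this.congr (ae_of_all _ fun p => ?_)
  simp only [Function.comp, Prod.snd_swap, Prod.fst_swap]
  rw [← hke, neg_sub]

lemma integral_mul_comp_sub' {h k : ℝ → ℝ} (hh : Integrable h) (hk : Integrable k)
    (hke : ∀ x, k (-x) = k x) :
    ∫ p : ℝ × ℝ, h p.1 * k (p.1 - p.2) = (∫ x, h x) * ∫ x, k x := by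
  rw [← integral_mul_comp_sub hh hk, Measure.volume_eq_prod,
    ← integral_prod_swap (fun p : ℝ × ℝ => h p.2 * k (p.1 - p.2))]
  refine integral_congr_ae (ae_of_all _ fun p => ?_)
  simp only [Prod.snd_swap, Prod.fst_swap]
  rw [← hke, neg_sub]

lemma sineS_sq_neg (x : ℝ) : sineS (-x) ^ 2 = sineS x ^ 2 := by rw [sineS_neg]

lemma integrable_mul_self {f : ℝ → ℝ} (hf : Continuous f) (hfc : HasCompactSupport f) :
    Integrable fun x => f x * f x :=
  (hf.mul hf).integrable_of_hasCompactSupport (hfc.mul_right (f' := f))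

/-- Expand the square; each of the two diagonal terms is `∫ f²` because `∫ S² = 1`. The increments
of `f` make the scaling visible. -/
lemma integral_sq_sub_eq {f : ℝ → ℝ} (hf : Continuous f) (hfc : HasCompactSupport f) :
    (∫ x, f x * f x) - ∫ p : ℝ × ℝ, f p.1 * f p.2 * sineS (p.1 - p.2) ^ 2 =
      (1 / 2) * ∫ p : ℝ × ℝ, (f p.1 - f p.2) ^ 2 * sineS (p.1 - p.2) ^ 2 := by
  have hi := integrable_mul_self hf hfc
  have h1 := integrable_mul_comp_sub hi integrable_sineS_sq
  have h2 := integrable_mul_comp_sub' hi integrable_sineS_sq sineS_sq_neg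
  have h3 : Integrable fun p : ℝ × ℝ => f p.1 * f p.2 * sineS (p.1 - p.2) ^ 2 :=
    integrable_mul_mul_sub hf hfc hf hfc (continuous_sineS.pow 2)
  have h4 : Integrable fun p : ℝ × ℝ => f p.2 * f p.2 * sineS (p.1 - p.2) ^ 2 +
      f p.1 * f p.1 * sineS (p.1 - p.2) ^ 2 := h1.add h2
  have e : ∀ p : ℝ × ℝ, (f p.1 - f p.2) ^ 2 * sineS (p.1 - p.2) ^ 2 =
      (f p.2 * f p.2 * sineS (p.1 - p.2) ^ 2 + f p.1 * f p.1 * sineS (p.1 - p.2) ^ 2) -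
        2 * (f p.1 * f p.2 * sineS (p.1 - p.2) ^ 2) := fun p => by ring
  rw [integral_congr_ae (ae_of_all _ e), integral_sub h4 (h3.const_mul 2),
    integral_add h1 h2, integral_const_mul,
    integral_mul_comp_sub hi integrable_sineS_sq,
    integral_mul_comp_sub' hi integrable_sineS_sq sineS_sq_neg, integral_sineS_sq]
  ring

/-- With `u = (x - y) / c`, the squared increment is at most `min(1, L² u²)` and `u² S² ≤ 1/c²`, so
the integrand is at most `(1 + L²) / (c² (1 + u²))`. It vanishes unless `x` or `y` lies in an
interval of length `4c`, and integrating `u` costs `cπ`: the powers of `c` cancel. -/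
lemma exists_bound_sineS_part : ∃ C, ∀ c : ℝ, 0 < c →
    ∫ p : ℝ × ℝ, (dilBump c p.1 - dilBump c p.2) ^ 2 * sineS (p.1 - p.2) ^ 2 ≤ C := by
  obtain ⟨L, hL0, hL, -, -⟩ := exists_lipschitz_bump
  refine ⟨(1 + L ^ 2) * (8 * Real.pi), fun c hc => ?_⟩
  set χ : ℝ → ℝ := (Set.Icc (-(2 * c)) (2 * c)).indicator 1 with hχ
  have hχi : Integrable χ :=
    (integrable_indicator_iff measurableSet_Icc).2
      (integrableOn_const (hs := by simp) (C := (1 : ℝ)))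
  have hχint : ∫ x, χ x = 4 * c := by
    rw [hχ, integral_indicator_one measurableSet_Icc, Real.volume_real_Icc_of_le (by linarith)]
    ring
  set r : ℝ → ℝ := fun u => (1 + (u / c) ^ 2)⁻¹ with hr
  have hri : Integrable r := integrable_inv_one_add_sq.comp_div hc.ne'
  have hrint : ∫ x, r x = c * Real.pi := by
    rw [hr, Measure.integral_comp_div (fun u : ℝ => (1 + u ^ 2)⁻¹), integral_univ_inv_one_add_sq,
      abs_of_pos hc, smul_eq_mul]
  have hre : ∀ x, r (-x) = r x := fun x => by simp only [hr, neg_div, neg_sq]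
  have h1 := integrable_mul_comp_sub hχi hri
  have h2 := integrable_mul_comp_sub' hχi hri hre
  have hpt : ∀ p : ℝ × ℝ, (dilBump c p.1 - dilBump c p.2) ^ 2 * sineS (p.1 - p.2) ^ 2 ≤
      ((1 + L ^ 2) / c ^ 2) * (χ p.2 * r (p.1 - p.2) + χ p.1 * r (p.1 - p.2)) := by
    rintro ⟨x, y⟩
    simp only
    have hχ0 : ∀ x, 0 ≤ χ x := fun x => Set.indicator_nonneg (fun _ _ => zero_le_one) x
    have hr0 : 0 ≤ r (x - y) := by positivity
    by_cases hxy : x ∈ Set.Icc (-(2 * c)) (2 * c) ∨ y ∈ Set.Icc (-(2 * c)) (2 * c)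
    · have hsum : 1 ≤ χ y + χ x := by
        rcases hxy with h | h
        · have : χ x = 1 := Set.indicator_of_mem h _
          linarith [hχ0 y]
        · have : χ y = 1 := Set.indicator_of_mem h _
          linarith [hχ0 x]
      have hd1 : (dilBump c x - dilBump c y) ^ 2 ≤ 1 := by
        have h1 := dilBump_mem_Icc c x
        have h2 := dilBump_mem_Icc c y
        rw [sq_le_one_iff_abs_le_one, abs_le]
        constructor <;> linarith [h1.1, h1.2, h2.1, h2.2]
      have hd2 : (dilBump c x - dilBump c y) ^ 2 ≤ L ^ 2 * ((x - y) / c) ^ 2 := by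
        rw [← sq_abs, ← mul_pow, ← sq_abs (L * _), abs_mul L, abs_of_nonneg hL0]
        gcongr
        rw [sub_div]
        exact hL _ _
      have hS : ((x - y) / c) ^ 2 * sineS (x - y) ^ 2 ≤ 1 / c ^ 2 := by
        have := abs_mul_sineS_le_one (x - y)
        rw [← sq_le_one_iff_abs_le_one] at this
        rw [div_pow, div_mul_eq_mul_div, ← mul_pow]
        gcongr
      set u := (x - y) / c
      set d := (dilBump c x - dilBump c y) ^ 2
      set s := sineS (x - y) ^ 2
      have hs0 : 0 ≤ s := sq_nonneg _
      have key : d * s * (1 + u ^ 2) ≤ (1 + L ^ 2) / c ^ 2 := by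
        have : d * (1 + u ^ 2) ≤ (1 + L ^ 2) * u ^ 2 := by nlinarith [sq_nonneg u]
        calc d * s * (1 + u ^ 2) = d * (1 + u ^ 2) * s := by ring
          _ ≤ (1 + L ^ 2) * u ^ 2 * s := by gcongr
          _ = (1 + L ^ 2) * (u ^ 2 * s) := by ring
          _ ≤ (1 + L ^ 2) * (1 / c ^ 2) := by gcongr
          _ = _ := by ring
      have hru : r (x - y) = (1 + u ^ 2)⁻¹ := rfl
      calc d * s ≤ (1 + L ^ 2) / c ^ 2 * r (x - y) := by
            rw [hru, ← div_eq_mul_inv, le_div_iff₀ (by positivity)]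
            exact key
        _ ≤ (1 + L ^ 2) / c ^ 2 * ((χ y + χ x) * r (x - y)) := by
            gcongr
            exact le_mul_of_one_le_left hr0 hsum
        _ = _ := by ring
    · push Not at hxy
      rw [dilBump_eq_zero hc hxy.1, dilBump_eq_zero hc hxy.2]
      simp only [sub_self, ne_eq, OfNat.ofNat_ne_zero, not_false_eq_true, zero_pow, zero_mul]
      have := hχ0 x
      have := hχ0 y
      positivity
  refine (integral_mono_of_nonneg (ae_of_all _ fun p => by positivity)
    ((h1.add h2).const_mul ((1 + L ^ 2) / c ^ 2)) (ae_of_all _ hpt)).trans_eq ?_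
  simp only [Pi.add_apply]
  rw [integral_const_mul, integral_add h1 h2, integral_mul_comp_sub hχi hri,
    integral_mul_comp_sub' hχi hri hre, hχint, hrint]
  field_simp
  ring

/-- A direct estimate with `G = O(1/|x|)` would lose a logarithm of `c`. As `G` is odd, the integral
may be antisymmetrised; the new factor `f(x) f'(y) - f(y) f'(x)` vanishes on the diagonal and is at
most `(L + L²)|x - y| / c²`, which absorbs the decay of `G`. What remains is `O(1/c²)` on a square
of area `16c²`. -/
lemma exists_bound_sineG_part : ∃ C, ∀ c : ℝ, 0 < c →
    |∫ p : ℝ × ℝ, dilBump c p.1 * deriv (dilBump c) p.2 * sineG (p.1 - p.2)| ≤ C := by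
  obtain ⟨L, hL0, hL, hL', hLd⟩ := exists_lipschitz_bump
  obtain ⟨M, hM0, -, hM⟩ := exists_abs_sineG_le
  refine ⟨8 * ((L + L ^ 2) * M), fun c hc => ?_⟩
  have hb := continuous_dilBump c
  have hbc := hasCompactSupport_dilBump hc
  have hd : Continuous (deriv (dilBump c)) := (contDiff_dilBump c).continuous_deriv (by norm_num)
  have h1 := integrable_mul_mul_sub hb hbc hd hbc.deriv continuous_sineG
  set I := ∫ p : ℝ × ℝ, dilBump c p.1 * deriv (dilBump c) p.2 * sineG (p.1 - p.2) with hI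
  have h2 := h1.swap
  have hswap : ∫ p : ℝ × ℝ, dilBump c p.2 * deriv (dilBump c) p.1 * sineG (p.1 - p.2) = -I := by
    rw [hI, Measure.volume_eq_prod, ← integral_prod_swap, ← integral_neg]
    refine integral_congr_ae (ae_of_all _ fun p => ?_)
    simp only [Prod.snd_swap, Prod.fst_swap]
    rw [← neg_sub p.1 p.2, sineG_neg]
    ring
  have h3 : Integrable fun p : ℝ × ℝ =>
      dilBump c p.2 * deriv (dilBump c) p.1 * sineG (p.1 - p.2) := by
    refine h2.neg.congr (ae_of_all _ fun p => ?_)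
    simp only [Pi.neg_apply, Function.comp, Prod.snd_swap, Prod.fst_swap]
    rw [← neg_sub p.1 p.2, sineG_neg]
    ring
  have h2I : 2 * I = ∫ p : ℝ × ℝ, (dilBump c p.1 * deriv (dilBump c) p.2 * sineG (p.1 - p.2) -
      dilBump c p.2 * deriv (dilBump c) p.1 * sineG (p.1 - p.2)) := by
    rw [integral_sub h1 h3, hswap]; ring
  set χ : ℝ → ℝ := (Set.Icc (-(2 * c)) (2 * c)).indicator 1 with hχ
  have hχi : Integrable χ :=
    (integrable_indicator_iff measurableSet_Icc).2
      (integrableOn_const (hs := by simp) (C := (1 : ℝ)))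
  have hχint : ∫ x, χ x = 4 * c := by
    rw [hχ, integral_indicator_one measurableSet_Icc, Real.volume_real_Icc_of_le (by linarith)]
    ring
  have hpt : ∀ p : ℝ × ℝ, ‖dilBump c p.1 * deriv (dilBump c) p.2 * sineG (p.1 - p.2) -
      dilBump c p.2 * deriv (dilBump c) p.1 * sineG (p.1 - p.2)‖ ≤
      ((L + L ^ 2) * M / c ^ 2) * (χ p.1 * χ p.2) := by
    rintro ⟨x, y⟩
    simp only
    by_cases hx : x ∈ Set.Icc (-(2 * c)) (2 * c)
    · by_cases hy : y ∈ Set.Icc (-(2 * c)) (2 * c)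
      · have hχx : χ x = 1 := Set.indicator_of_mem hx _
        have hχy : χ y = 1 := Set.indicator_of_mem hy _
        rw [hχx, hχy, Real.norm_eq_abs, deriv_dilBump, deriv_dilBump, dilBump, dilBump]
        have hb1 : |bump (x / c)| ≤ 1 := by
          rw [abs_of_nonneg bump.nonneg]; exact bump.le_one
        have e : bump (x / c) * (deriv bump (y / c) / c) * sineG (x - y) -
            bump (y / c) * (deriv bump (x / c) / c) * sineG (x - y) =
            ((bump (x / c) * (deriv bump (y / c) - deriv bump (x / c)) +
              deriv bump (x / c) * (bump (x / c) - bump (y / c))) * sineG (x - y)) / c := by ring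
        have hA : |bump (x / c) * (deriv bump (y / c) - deriv bump (x / c)) +
              deriv bump (x / c) * (bump (x / c) - bump (y / c))| ≤ (L + L ^ 2) * (|x - y| / c) := by
          have hxy : |x / c - y / c| = |x - y| / c := by rw [← sub_div, abs_div, abs_of_pos hc]
          refine (abs_add_le _ _).trans ?_
          rw [abs_mul, abs_mul, add_mul, ← hxy, sq, mul_assoc]
          refine add_le_add ?_ (mul_le_mul (hLd _) (hL _ _) (abs_nonneg _) hL0)
          rw [abs_sub_comm]
          simpa using mul_le_mul hb1 (hL' (x / c) (y / c)) (abs_nonneg _) zero_le_one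
        have hG := hM (x - y)
        rw [abs_mul] at hG
        rw [e, abs_div, abs_mul, abs_of_pos hc, div_le_iff₀ hc]
        calc _ ≤ (L + L ^ 2) * (|x - y| / c) * |sineG (x - y)| := by gcongr
          _ = (L + L ^ 2) / c * (|x - y| * |sineG (x - y)|) := by ring
          _ ≤ (L + L ^ 2) / c * M := by gcongr
          _ = _ := by field_simp
      · rw [dilBump_eq_zero hc hy, deriv_dilBump_eq_zero hc hy, hχ, Set.indicator_of_notMem hy]
        simp
    · rw [dilBump_eq_zero hc hx, deriv_dilBump_eq_zero hc hx, hχ, Set.indicator_of_notMem hx]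
      simp
  have hbd := norm_integral_le_of_norm_le
    ((hχi.mul_prod hχi).const_mul ((L + L ^ 2) * M / c ^ 2)) (ae_of_all _ hpt)
  rw [integral_const_mul, integral_prod_mul, hχint, ← Measure.volume_eq_prod, ← h2I,
    Real.norm_eq_abs, abs_mul, abs_two] at hbd
  have e2 : (L + L ^ 2) * M / c ^ 2 * (4 * c * (4 * c)) = 16 * ((L + L ^ 2) * M) := by
    field_simp; ring
  rw [e2] at hbd
  linarith

/-! ### Decorrelation of distant scales -/

lemma tendsto_div_natCast (x : ℝ) : Tendsto (fun n : ℕ => x / (n : ℝ)) atTop (𝓝 0) :=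
  tendsto_const_nhds.div_atTop tendsto_natCast_atTop_atTop

lemma tendsto_dilBump (x : ℝ) : Tendsto (fun n : ℕ => dilBump n x) atTop (𝓝 1) := by
  have h := (contDiff_bump.continuous.tendsto 0).comp (tendsto_div_natCast x)
  rwa [bump_eq_one (by simp)] at h

/-- The wide bump tends to `1`, so both terms converge to `∫ f`, the second one because `∫ S² = 1`.
-/
lemma tendsto_sineS_part {f : ℝ → ℝ} (hf : Continuous f) (hfc : HasCompactSupport f) :
    Tendsto (fun n : ℕ => (∫ x, f x * dilBump n x) -
      ∫ p : ℝ × ℝ, f p.1 * dilBump n p.2 * sineS (p.1 - p.2) ^ 2) atTop (𝓝 0) := by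
  have hfi : Integrable f := hf.integrable_of_hasCompactSupport hfc
  have hle : ∀ (n : ℕ) x, ‖dilBump n x‖ ≤ 1 := fun n x => by
    have h := dilBump_mem_Icc n x
    rw [Real.norm_of_nonneg h.1]; exact h.2
  have h1 : Tendsto (fun n : ℕ => ∫ x, f x * dilBump n x) atTop (𝓝 (∫ x, f x)) := by
    refine tendsto_integral_of_dominated_convergence (fun x => ‖f x‖)
      (fun n => (hf.mul (continuous_dilBump n)).aestronglyMeasurable) hfi.norm
      (fun n => ae_of_all _ fun x => ?_) (ae_of_all _ fun x => ?_)
    · rw [norm_mul]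
      exact mul_le_of_le_one_right (norm_nonneg _) (hle n x)
    · simpa using (tendsto_dilBump x).const_mul (f x)
  have h2i := integrable_mul_comp_sub' hfi integrable_sineS_sq sineS_sq_neg
  have h2 : Tendsto (fun n : ℕ => ∫ p : ℝ × ℝ, f p.1 * dilBump n p.2 * sineS (p.1 - p.2) ^ 2) atTop
      (𝓝 (∫ p : ℝ × ℝ, f p.1 * sineS (p.1 - p.2) ^ 2)) := by
    refine tendsto_integral_of_dominated_convergence (fun p => ‖f p.1 * sineS (p.1 - p.2) ^ 2‖)
      (fun n => (continuous_mul_comp hf (continuous_dilBump n)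
        (continuous_sineS.pow 2)).aestronglyMeasurable) h2i.norm
      (fun n => ae_of_all _ fun p => ?_) (ae_of_all _ fun p => ?_)
    · rw [mul_right_comm, norm_mul]
      exact mul_le_of_le_one_right (norm_nonneg _) (hle n p.2)
    · simpa using ((tendsto_dilBump p.2).const_mul (f p.1)).mul_const (sineS (p.1 - p.2) ^ 2)
  rw [integral_mul_comp_sub' hfi integrable_sineS_sq sineS_sq_neg, integral_sineS_sq, mul_one] at h2
  simpa using h1.sub h2

/-- The substitution `y = c z` absorbs the factor `1/c` of the derivative, so the scale remains only
inside `G`. -/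
lemma integral_deriv_dilBump {f : ℝ → ℝ} (hf : Continuous f) (hfc : HasCompactSupport f)
    {c : ℝ} (hc : 0 < c) :
    ∫ p : ℝ × ℝ, f p.1 * deriv (dilBump c) p.2 * sineG (p.1 - p.2) =
      ∫ p : ℝ × ℝ, f p.1 * deriv bump p.2 * sineG (p.1 - c * p.2) := by
  have hd : Continuous (deriv (dilBump c)) := (contDiff_dilBump c).continuous_deriv (by norm_num)
  have hdb := continuous_deriv_bump
  have hG := continuous_sineG
  have hi : Integrable fun p : ℝ × ℝ => f p.1 * deriv bump p.2 * sineG (p.1 - c * p.2) := by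
    refine Continuous.integrable_of_hasCompactSupport (by fun_prop) ?_
    refine HasCompactSupport.of_support_subset_isCompact
      (IsCompact.prod (s := tsupport f) (t := tsupport (deriv bump)) hfc
        hasCompactSupport_bump.deriv) fun p hp => ⟨?_, ?_⟩
    · exact subset_tsupport _ fun h => hp (by simp [h])
    · exact subset_tsupport _ fun h => hp (by simp [h])
  rw [Measure.volume_eq_prod, integral_prod _ hi, integral_prod _ (integrable_mul_mul_sub hf hfc hd
    (hasCompactSupport_dilBump hc).deriv hG)]
  refine integral_congr_ae (ae_of_all _ fun x => ?_)
  simp only [mul_assoc, integral_const_mul]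
  congr 1
  have h := Measure.integral_comp_div (fun z => deriv bump z * sineG (x - c * z)) c
  rw [abs_of_pos hc, smul_eq_mul] at h
  have e : ∀ y, deriv (dilBump c) y * sineG (x - y) =
      c⁻¹ * (deriv bump (y / c) * sineG (x - c * (y / c))) := fun y => by
    rw [deriv_dilBump, mul_div_cancel₀ _ hc.ne']; ring
  rw [integral_congr_ae (ae_of_all _ e), integral_const_mul, h, inv_mul_cancel_left₀ hc.ne']

/-- After rescaling, dominated convergence applies: for `z ≠ 0` the argument `x - n z` leaves every
bounded set and `G` tends to `0` at infinity. -/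
lemma tendsto_sineG_part {f : ℝ → ℝ} (hf : Continuous f) (hfc : HasCompactSupport f) :
    Tendsto (fun n : ℕ => ∫ p : ℝ × ℝ, f p.1 * deriv (dilBump n) p.2 * sineG (p.1 - p.2))
      atTop (𝓝 0) := by
  obtain ⟨M, hM0, hM, -⟩ := exists_abs_sineG_le
  have hdb := continuous_deriv_bump
  have hG := continuous_sineG
  have hfi : Integrable f := hf.integrable_of_hasCompactSupport hfc
  have hbi : Integrable (deriv bump) :=
    hdb.integrable_of_hasCompactSupport hasCompactSupport_bump.deriv
  have hne : ∀ᵐ p : ℝ × ℝ, p.2 ≠ 0 :=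
    Measure.quasiMeasurePreserving_snd.ae (compl_mem_ae_iff.2 (measure_singleton (0 : ℝ)))
  have h : Tendsto (fun n : ℕ => ∫ p : ℝ × ℝ, f p.1 * deriv bump p.2 * sineG (p.1 - n * p.2)) atTop
      (𝓝 (∫ _ : ℝ × ℝ, (0 : ℝ))) := by
    refine tendsto_integral_of_dominated_convergence (fun p => ‖f p.1 * deriv bump p.2‖ * M)
      (fun n => Continuous.aestronglyMeasurable (by fun_prop))
      ((hfi.mul_prod hbi).norm.mul_const M)
      (fun n => ae_of_all _ fun p => ?_) ?_
    · rw [norm_mul]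
      exact mul_le_mul_of_nonneg_left (hM _) (norm_nonneg _)
    · filter_upwards [hne] with p hp
      have h0 : Tendsto (fun n : ℕ => p.1 - n * p.2) atTop (Bornology.cobounded ℝ) := by
        rw [← tendsto_norm_atTop_iff_cobounded]
        have h1 : Tendsto (fun n : ℕ => (n : ℝ) * |p.2| - |p.1|) atTop atTop :=
          tendsto_atTop_add_const_right _ _
            (tendsto_natCast_atTop_atTop.atTop_mul_const (abs_pos.2 hp))
        refine tendsto_atTop_mono (fun n => ?_) h1
        have := abs_sub_abs_le_abs_sub (n * p.2) p.1
        rw [abs_mul, Nat.abs_cast, abs_sub_comm] at this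
        exact this
      simpa using (tendsto_sineG_cobounded.comp h0).const_mul (f p.1 * deriv bump p.2)
  rw [integral_zero] at h
  refine h.congr' ?_
  filter_upwards [eventually_gt_atTop 0] with n hn
  rw [integral_deriv_dilBump hf hfc (by exact_mod_cast hn)]

lemma tendsto_covariance_dilBump {P : Measure Conf} (hP : IsPfaffianProcess P kernelSine4)
    {c : ℝ} (hc : 0 < c) :
    Tendsto (fun n : ℕ => cov[Conf.linStat (dilBump c), Conf.linStat (dilBump n); P])
      atTop (𝓝 0) := by
  have h := ((tendsto_sineS_part (continuous_dilBump c) (hasCompactSupport_dilBump hc)).const_mul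
    (1 / 2)).add ((tendsto_sineG_part (continuous_dilBump c)
      (hasCompactSupport_dilBump hc)).const_mul (1 / 4))
  simp only [mul_zero, add_zero] at h
  refine h.congr' ?_
  filter_upwards [eventually_gt_atTop 0] with n hn
  rw [covariance_linStat hP (continuous_dilBump c) (hasCompactSupport_dilBump hc)
    ((contDiff_dilBump n).of_le one_le_two) (hasCompactSupport_dilBump (by exact_mod_cast hn))]

lemma exists_bound_covariance_dilBump {P : Measure Conf} (hP : IsPfaffianProcess P kernelSine4):
    ∃ C, ∀ c : ℝ, 0 < c → cov[Conf.linStat (dilBump c), Conf.linStat (dilBump c); P] ≤ C := by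
  obtain ⟨C₁, h₁⟩ := exists_bound_sineS_part
  obtain ⟨C₂, h₂⟩ := exists_bound_sineG_part
  refine ⟨(1 / 4) * C₁ + (1 / 4) * C₂, fun c hc => ?_⟩
  rw [covariance_linStat hP (continuous_dilBump c) (hasCompactSupport_dilBump hc)
    ((contDiff_dilBump c).of_le one_le_two) (hasCompactSupport_dilBump hc),
    integral_sq_sub_eq (continuous_dilBump c) (hasCompactSupport_dilBump hc)]
  have := h₁ c hc
  have := (le_abs_self _).trans (h₂ c hc)
  linarith

/-! ### Averaging over separated scales -/

/-- There are test functions equal to `1` on a given bounded interval whose linear statistics have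
arbitrarily small variance. -/
lemma exists_variance_linStat_le {P : Measure Conf} (hP : IsPfaffianProcess P kernelSine4)
    (R : ℝ) {ε : ℝ} (hε : 0 < ε) :
    ∃ f : ℝ → ℝ, Continuous f ∧ HasCompactSupport f ∧ (∀ x, |x| ≤ R → f x = 1) ∧
      Var[Conf.linStat f; P] ≤ ε := by
  have := hP.isProbabilityMeasure
  obtain ⟨C, hC⟩ := exists_bound_covariance_dilBump hP
  -- The scales are chosen recursively, each so wide that it almost decorrelates from all earlier
  -- ones; `R ≤ n` keeps the bumps equal to `1` on the given interval.
  obtain ⟨s, hs, hcov⟩ := exists_seq_of_forall_finset_exists (fun n : ℕ => 0 < n ∧ R ≤ n)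
    (fun m n : ℕ => |cov[Conf.linStat (dilBump m), Conf.linStat (dilBump n); P]| ≤ ε / 2)
    (fun t ht => by
      have h1 : ∀ᶠ n : ℕ in atTop, ∀ m ∈ t,
          |cov[Conf.linStat (dilBump m), Conf.linStat (dilBump n); P]| ≤ ε / 2 := by
        rw [Filter.eventually_all_finset]
        intro m hm
        have h2 := (tendsto_covariance_dilBump hP (c := m) (by exact_mod_cast (ht m hm).1)).abs
        rw [abs_zero] at h2
        exact (h2.eventually_lt_const (half_pos hε)).mono fun n hn => hn.le
      obtain ⟨n, hn1, hn2, hn3⟩ := (h1.and ((eventually_gt_atTop 0).and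
        (tendsto_natCast_atTop_atTop.eventually_ge_atTop R))).exists
      exact ⟨n, ⟨hn2, hn3⟩, hn1⟩)
  have hspos : ∀ i, (0 : ℝ) < s i := fun i => by exact_mod_cast (hs i).1
  -- So many terms that the diagonal contributes `C / N ≤ ε / 2`; the maximum with `0` forces `N >
  -- 0`.
  obtain ⟨N, hN⟩ := exists_nat_gt (max 0 (C / (ε / 2)))
  have hN0 : (0 : ℝ) < N := (le_max_left _ _).trans_lt hN
  have hNC : C ≤ N * (ε / 2) := by
    rw [← div_le_iff₀ (half_pos hε)]; exact ((le_max_right _ _).trans_lt hN).le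
  set f : ℝ → ℝ := fun x => (N : ℝ)⁻¹ * ∑ i ∈ Finset.range N, dilBump (s i) x with hf
  have hfc : Continuous f := by
    have := fun i => continuous_dilBump (s i)
    fun_prop
  have hlin : Conf.linStat f = fun ξ => (N : ℝ)⁻¹ * ∑ i ∈ Finset.range N,
      Conf.linStat (dilBump (s i)) ξ := by
    ext ξ
    have := ξ.locallyFinite
    simp only [Conf.linStat, hf]
    rw [integral_const_mul, integral_finsetSum]
    exact fun i _ => (continuous_dilBump _).integrable_of_hasCompactSupport
      (hasCompactSupport_dilBump (hspos i))
  refine ⟨f, hfc, ?_, fun x hx => ?_, ?_⟩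
  · have : ∀ t : Finset ℕ, HasCompactSupport fun x => ∑ i ∈ t, dilBump (s i) x := by
      intro t
      induction t using Finset.induction_on with
      | empty => exact HasCompactSupport.zero
      | insert a t ha ih =>
        simp only [Finset.sum_insert ha]
        exact (hasCompactSupport_dilBump (hspos a)).add ih
    exact (this _).mul_left
  · have : ∀ i ∈ Finset.range N, dilBump (s i) x = 1 := fun i _ =>
      dilBump_eq_one (hspos i) (hx.trans (hs i).2)
    simp only [hf]
    rw [Finset.sum_congr rfl this]
    simp [hN0.ne']
  · have hmem : ∀ i ∈ Finset.range N, MemLp (Conf.linStat (dilBump (s i))) 2 P := fun i _ =>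
      memLp_linStat hP (continuous_dilBump _) (hasCompactSupport_dilBump (hspos i))
    rw [hlin, variance_const_mul, variance_fun_sum' hmem]
    have hle : ∀ i ∈ Finset.range N, ∀ j ∈ Finset.range N,
        cov[Conf.linStat (dilBump (s i)), Conf.linStat (dilBump (s j)); P] ≤
          (if i = j then C else 0) + ε / 2 := by
      intro i _ j _
      rcases lt_trichotomy i j with h | rfl | h
      · rw [if_neg h.ne, zero_add]
        exact (le_abs_self _).trans (hcov i j h)
      · rw [if_pos rfl]
        exact (hC _ (hspos i)).trans (by linarith)
      · rw [if_neg h.ne', zero_add, covariance_comm]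
        exact (le_abs_self _).trans (hcov j i h)
    have hsum := Finset.sum_le_sum fun i hi => Finset.sum_le_sum (hle i hi)
    have htot : ∑ i ∈ Finset.range N, ∑ j ∈ Finset.range N,
        ((if i = j then C else 0) + ε / 2) = N * C + N * (N * (ε / 2)) := by
      simp only [Finset.sum_add_distrib, Finset.sum_ite_eq, Finset.sum_const, Finset.card_range,
        nsmul_eq_mul]
      rw [Finset.sum_congr rfl fun i hi => if_pos hi]
      simp
    rw [htot] at hsum
    calc _ ≤ ((N : ℝ)⁻¹) ^ 2 * (N * C + N * (N * (ε / 2))) := by gcongr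
      _ ≤ ((N : ℝ)⁻¹) ^ 2 * (N * (N * (ε / 2)) + N * (N * (ε / 2))) := by gcongr
      _ = ε := by field_simp; ring

/-! ### From small variance to rigidity -/

lemma continuous_linStat {f : ℝ → ℝ} (hf : Continuous f) (hfc : HasCompactSupport f) :
    Continuous (Conf.linStat f) := by
  let φ : C_c(ℝ, ℂ) :=
    { toFun := fun x => (f x : ℂ)
      continuous_toFun := by fun_prop
      hasCompactSupport' := hfc.comp_left Complex.ofReal_zero }
  have h : Continuous fun ξ : Conf => ∫ x, φ x ∂ξ.toMeasure :=
    continuous_iInf_dom (i := φ) continuous_induced_dom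
  have e : Conf.linStat f = fun ξ : Conf => (∫ x, φ x ∂ξ.toMeasure).re := by
    ext ξ
    have : ∫ x, φ x ∂ξ.toMeasure = ((∫ x, f x ∂ξ.toMeasure : ℝ) : ℂ) := integral_complex_ofReal
    rw [this, Complex.ofReal_re, Conf.linStat]
  rw [e]
  exact Complex.continuous_re.comp h

lemma linStat_eq_add_restrict_compl {f : ℝ → ℝ} (hf : Continuous f) (hfc : HasCompactSupport f)
    {B : Set ℝ} (hB : MeasurableSet B) (hfB : ∀ x ∈ B, f x = 1) (ξ : Conf) :
    Conf.linStat f ξ = (ξ.toMeasure B).toReal + Conf.linStat f (ξ.restrict Bᶜ) := by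
  have := ξ.locallyFinite
  have hi : Integrable f ξ.toMeasure := hf.integrable_of_hasCompactSupport hfc
  rw [Conf.linStat, ← integral_add_compl hB hi, setIntegral_congr_fun hB hfB]
  simp [Conf.linStat, Conf.restrict, Measure.real]

lemma Conf.exists_nat_measure_eq (ξ : Conf) {B : Set ℝ} (hB : MeasurableSet B)
    (hb : Bornology.IsBounded B) : ∃ n : ℕ, (ξ.toMeasure B).toReal = n := by
  have := ξ.locallyFinite
  obtain ⟨n, hn⟩ := ξ.integerValued B hB
  cases n with
  | top => exact absurd hn (by simpa using hb.measure_lt_top.ne)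
  | coe n => exact ⟨n, by rw [hn]; simp⟩

/-- Chebyshev's inequality with variances at most `1 / (n + 1)` gives convergence in probability; a
subsequence converges almost surely. -/
lemma exists_seq_tendsto_linStat {P : Measure Conf} (hP : IsPfaffianProcess P kernelSine4)
    (R : ℝ) : ∃ f : ℕ → ℝ → ℝ, (∀ n, Continuous (f n) ∧ HasCompactSupport (f n) ∧
      ∀ x, |x| ≤ R → f n x = 1) ∧
      ∀ᵐ ξ ∂P, Tendsto (fun n => Conf.linStat (f n) ξ - ∫ η, Conf.linStat (f n) η ∂P)
        atTop (𝓝 0) := by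
  have := hP.isProbabilityMeasure
  choose f hfc hfs hf1 hfv using fun n : ℕ =>
    exists_variance_linStat_le hP R (ε := ((n : ℝ) + 1)⁻¹) (by positivity)
  have hmem := fun n => memLp_linStat hP (hfc n) (hfs n)
  have hmeas : TendstoInMeasure P
      (fun n ξ => Conf.linStat (f n) ξ - ∫ η, Conf.linStat (f n) η ∂P) atTop (fun _ => 0) := by
    rw [tendstoInMeasure_iff_norm]
    intro δ hδ
    have h1 : Tendsto (fun n : ℕ => ENNReal.ofReal (((n : ℝ) + 1)⁻¹ / δ ^ 2)) atTop (𝓝 0) := by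
      rw [← ENNReal.ofReal_zero]
      refine ENNReal.tendsto_ofReal ?_
      simpa using (tendsto_one_div_add_atTop_nhds_zero_nat (𝕜 := ℝ)).div_const (δ ^ 2)
    refine tendsto_of_tendsto_of_tendsto_of_le_of_le tendsto_const_nhds h1
      (fun n => zero_le) fun n => ?_
    simp only [sub_zero, Real.norm_eq_abs]
    refine (meas_ge_le_variance_div_sq (hmem n) hδ).trans (ENNReal.ofReal_le_ofReal ?_)
    gcongr
    exact hfv n
  obtain ⟨ns, -, hns⟩ := hmeas.exists_seq_tendsto_ae
  exact ⟨fun n => f (ns n), fun n => ⟨hfc _, hfs _, hf1 _⟩, hns⟩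

end PfaffianPP

theorem proposition1p6 (P : MeasureTheory.Measure PfaffianPP.Conf)
    (hP : PfaffianPP.IsPfaffianProcess P PfaffianPP.kernelSine4) :
    PfaffianPP.IsNumberRigid P := by
  intro B hB hb
  obtain ⟨R, hR⟩ := hb.subset_closedBall 0
  obtain ⟨f, hf, hlim⟩ := PfaffianPP.exists_seq_tendsto_linStat hP R
  have hfB : ∀ n, ∀ x ∈ B, f n x = 1 := fun n x hx =>
    (hf n).2.2 x (by simpa using hR hx)
  have hm : ∀ n, Measurable fun η : PfaffianPP.Conf =>
      (∫ ξ, PfaffianPP.Conf.linStat (f n) ξ ∂P) - PfaffianPP.Conf.linStat (f n) η := fun n =>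
    (PfaffianPP.continuous_linStat (hf n).1 (hf n).2.1).measurable.const_sub _
  -- The mean minus the outside statistic converges to `ξ(B)`. The `limsup` is measurable on all of
  -- `Conf`, whether or not the limit exists, and adding `1 / 2` before the floor rounds to the
  -- nearest integer.
  refine ⟨fun η => ⌊Filter.limsup (fun n => (∫ ξ, PfaffianPP.Conf.linStat (f n) ξ ∂P) -
    PfaffianPP.Conf.linStat (f n) η) Filter.atTop + 1 / 2⌋,
    ((Measurable.limsup hm).add_const _).floor, ?_⟩
  filter_upwards [hlim] with ξ hξ
  obtain ⟨N, hN⟩ := ξ.exists_nat_measure_eq hB hb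
  have h : Filter.Tendsto (fun n => (∫ ξ, PfaffianPP.Conf.linStat (f n) ξ ∂P) -
      PfaffianPP.Conf.linStat (f n) (ξ.restrict Bᶜ)) Filter.atTop (nhds N) := by
    have h1 := hξ.const_sub (N : ℝ)
    rw [sub_zero] at h1
    refine h1.congr fun n => ?_
    rw [PfaffianPP.linStat_eq_add_restrict_compl (hf n).1 (hf n).2.1 hB (hfB n) ξ, hN]
    ring
  rw [h.limsup_eq, hN]
  have : ⌊(N : ℝ) + 1 / 2⌋ = N := by
    rw [Int.floor_eq_iff]; constructor <;> push_cast <;> linarith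
  rw [this]; simp
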